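/- Let $\Sigma$ be a smooth three-manifold, $\mathcal I\subset\mathbb R$ an open interval and $\lambda\in\mathbb R$. Let $\{\beta_t,\mathfrak e^t=(e^t_u,e^t_l,e^t_n)\}_{t\in\mathcal I}$ be a smooth family of strictly positive functions and coframes on $\Sigma$, and set $$h_t=e^t_u\otimes e^t_u+e^t_l\otimes e^t_l+e^t_n\otimes e^t_n,\qquad \Theta_t=-\frac1{2\beta_t}\,\partial_t h_t .$$ For a one-form $\alpha$ on $\Sigma$, write $\Theta_t(\alpha)=\Theta_t(\alpha^{\sharp},\cdot)$ and $\mathrm d\beta_t(\alpha)=\mathrm d\beta_t(\alpha^\sharp)$, where $\alpha^\sharp$ is the $h_t$-dual vector field. Suppose that $\{\beta_t,\mathfrak e^t\}_{t\in\mathcal I}$ is a real Killing spinorial flow, that is, for all $t\in\mathcal I$: $$\partial_t e^t_u+\mathrm d\beta_t(e^t_u)\,e^t_u+\beta_t\Theta_t(e^t_u)=\mathrm d\beta_t+\lambda\beta_t e^t_l,\qquad \partial_t e^t_l+\beta_t\Theta_t(e^t_l)=-(\mathrm d\beta_t(e^t_l)+\lambda\beta_t)\,e^t_u,$$ $$\partial_t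 e^t_n+\beta_t\Theta_t(e^t_n)=-\mathrm d\beta_t(e^t_n)\,e^t_u,\qquad \partial_t(\Theta_t(e^t_u))+\lambda\,\partial_t e^t_l=-\mathrm d(\mathrm d\beta_t(e^t_u)),$$ $$\mathrm d e^t_u=(\Theta_t(e^t_u)-\lambda e^t_l)\wedge e^t_u,\qquad \mathrm d e^t_l=\Theta_t(e^t_l)\wedge e^t_u,\qquad \mathrm d e^t_n+\lambda e^t_l\wedge e^t_n=\Theta_t(e^t_n)\wedge e^t_u,$$ and the one-form $\Theta_t(e^t_u)+\lambda e^t_l$ is exact on $\Sigma$. Then there is a smooth family of functions $\{\mathfrak f_t\}_{t\in\mathcal I}$ on $\Sigma$ such that $$\mathrm d\mathfrak f_t=-\Theta_t(e^t_u)-\lambda e^t_l,\qquad \partial_t\mathfrak f_t=\mathrm d\beta_t(e^t_u),$$ and for every such family the Ricci tensor of the Lorentzian metric $g=-\beta_t^2\,\mathrm dt\otimes\mathrm dt+h_t$ on $M=\mathcal I\times\Sigma$ is $$\mathrm{Ric}^g=-3\lambda^2 g+\tfrac12\,H\,e^{-2\mathfrak f_t}\,u\otimes u,$$ where $u=e^{\mathfrak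 f_t}(\beta_t\,\mathrm dt+e^t_u)$ and $H(t,p)=\big(\mathrm R_{h_t}-|\Theta_t|^2_{h_t}+\mathrm{Tr}_{h_t}(\Theta_t)^2+6\lambda^2\big)\big|_p$, with $\mathrm R_{h_t}$ the scalar curvature of $h_t$. -/

import Mathlib

open scoped Manifold ContDiff
open Bundle Set

noncomputable section

namespace KillingFlow

/-! ### Curvature of a (pseudo-Riemannian) metric in coordinates

`b` is a basis of the vector space `E` and `G x i j` are the components of a metric tensor on an
open set of `E` in the linear coordinates defined by `b`. -/

section Coordinates

variable {E : Type*} [NormedAddCommGroup E] [NormedSpace ℝ E]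
  {ι : Type*} [Fintype ι] [DecidableEq ι] (b : Module.Basis ι ℝ E)

/-- The partial derivative `∂_i f` at `x`. -/
def partialD (i : ι) (f : E → ℝ) (x : E) : ℝ :=
  fderiv ℝ f x (b i)

/-- The Christoffel symbols
`Γ^k_ij = ½ ∑_l G^kl (∂_i G_jl + ∂_j G_il - ∂_l G_ij)`. -/
def christoffel (G : E → Matrix ι ι ℝ) (k i j : ι) (x : E) : ℝ :=
  1 / 2 * ∑ l, (G x)⁻¹ k l *
    (partialD b i (fun y => G y j l) x + partialD b j (fun y => G y i l) x
      - partialD b l (fun y => G y i j) x)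

/-- The components
`Ric_ij = ∑_k (∂_k Γ^k_ij - ∂_i Γ^k_kj + ∑_l (Γ^k_kl Γ^l_ij - Γ^k_il Γ^l_kj))`
of the Ricci tensor `Ric(v,w) = tr (u ↦ R(u,v)w)`. -/
def ricciCoord (G : E → Matrix ι ι ℝ) (i j : ι) (x : E) : ℝ :=
  ∑ k, (partialD b k (christoffel b G k i j) x - partialD b i (christoffel b G k k j) x
    + ∑ l, (christoffel b G k k l x * christoffel b G l i j x
      - christoffel b G k i l x * christoffel b G l k j x))

/-- The scalar curvature `∑_ij G^ij Ric_ij`. -/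
def scalarCoord (G : E → Matrix ι ι ℝ) (x : E) : ℝ :=
  ∑ i, ∑ j, (G x)⁻¹ i j * ricciCoord b G i j x

end Coordinates

/-! ### Tensors on a manifold -/

section Manifold

variable {E : Type*} [NormedAddCommGroup E] [NormedSpace ℝ E] {H : Type*} [TopologicalSpace H]
  (I : ModelWithCorners ℝ E H) {M : Type*} [TopologicalSpace M] [ChartedSpace H M]

/-- The differential at the point of coordinates `x` of the inverse of the preferred chart
at `p`. -/
def chartSymmDeriv (p : M) (x : E) : E →L[ℝ] TangentSpace I ((extChartAt I p).symm x) :=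
  mfderiv 𝓘(ℝ, E) I (extChartAt I p).symm x

/-- The differential at `p` of the preferred chart at `p`. -/
def chartDeriv (p : M) : TangentSpace I p →L[ℝ] E :=
  mfderiv I 𝓘(ℝ, E) (extChartAt I p) p

/-- The exterior derivative of a one-form: `dα(v,w) = ∂_v (α(w)) - ∂_w (α(v))` for vector fields
`v`, `w` that are constant in the preferred chart at `p`. -/
def extD (α : ∀ q : M, TangentSpace I q →L[ℝ] ℝ) (p : M) (v w : TangentSpace I p) : ℝ :=
  fderiv ℝ (fun x => α ((extChartAt I p).symm x) (chartSymmDeriv I p x (chartDeriv I p w)))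
      (extChartAt I p p) (chartDeriv I p v)
    - fderiv ℝ (fun x => α ((extChartAt I p).symm x) (chartSymmDeriv I p x (chartDeriv I p v)))
      (extChartAt I p p) (chartDeriv I p w)

variable {ι : Type*} [Fintype ι] [DecidableEq ι] (b : Module.Basis ι ℝ E)

/-- The components of a bilinear form in the preferred chart at `p`. -/
def metricInChart (g : ∀ q : M, TangentSpace I q →L[ℝ] TangentSpace I q →L[ℝ] ℝ) (p : M) (x : E) :
    Matrix ι ι ℝ :=
  Matrix.of fun i j => g ((extChartAt I p).symm x) (chartSymmDeriv I p x (b i))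
    (chartSymmDeriv I p x (b j))

/-- The Ricci tensor of a metric `g`, computed at each point `p` in the preferred chart at `p`
(and in the linear coordinates of the model space defined by `b`, on which it does not depend). -/
def ricci (g : ∀ q : M, TangentSpace I q →L[ℝ] TangentSpace I q →L[ℝ] ℝ) (p : M)
    (v w : TangentSpace I p) : ℝ :=
  ∑ i, ∑ j, b.repr (chartDeriv I p v) i * b.repr (chartDeriv I p w) j
    * ricciCoord b (metricInChart I b g p) i j (extChartAt I p p)

/-- The scalar curvature of a metric `g`, computed at `p` in the preferred chart at `p`. -/
def scalarCurv (g : ∀ q : M, TangentSpace I q →L[ℝ] TangentSpace I q →L[ℝ] ℝ) (p : M) : ℝ :=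
  scalarCoord b (metricInChart I b g p) (extChartAt I p p)

variable {I}

/-- The wedge product of two covectors. -/
def wedge {p : M} (α γ : TangentSpace I p →L[ℝ] ℝ) (v w : TangentSpace I p) : ℝ :=
  α v * γ w - α w * γ v

/-- The tensor product of two covectors. -/
def tensor {p : M} (α γ : TangentSpace I p →L[ℝ] ℝ) :
    TangentSpace I p →L[ℝ] TangentSpace I p →L[ℝ] ℝ :=
  α.smulRight γ

/-- The vector metrically dual to a covector. -/
def sharp {p : M} (h : TangentSpace I p →L[ℝ] TangentSpace I p →L[ℝ] ℝ)
    (α : TangentSpace I p →L[ℝ] ℝ) : TangentSpace I p :=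
  h.inverse α

/-- The trace of a bilinear form with respect to a metric. -/
def traceWrt {p : M} (h B : TangentSpace I p →L[ℝ] TangentSpace I p →L[ℝ] ℝ) : ℝ :=
  LinearMap.trace ℝ (TangentSpace I p) (h.inverse ∘L B : TangentSpace I p →L[ℝ] TangentSpace I p)

/-- The squared norm `B_ij B^ij` of a symmetric bilinear form with respect to a metric. -/
def normSqWrt {p : M} (h B : TangentSpace I p →L[ℝ] TangentSpace I p →L[ℝ] ℝ) : ℝ :=
  LinearMap.trace ℝ (TangentSpace I p)
    ((h.inverse ∘L B) ∘L (h.inverse ∘L B) : TangentSpace I p →L[ℝ] TangentSpace I p)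

end Manifold

/-- The standard basis of `ℝ³`. -/
def basis3 : Module.Basis (Fin 3) ℝ (EuclideanSpace ℝ (Fin 3)) :=
  (EuclideanSpace.basisFun (Fin 3) ℝ).toBasis

/-- The standard basis of `ℝ × ℝ³`. -/
def basis4 : Module.Basis (Unit ⊕ Fin 3) ℝ (ℝ × EuclideanSpace ℝ (Fin 3)) :=
  (Module.Basis.singleton Unit ℝ).prod basis3

/-! ### Families of functions and coframes on a three-manifold -/

/-- Families `β_t` of functions and `(e_u, e_l, e_n)_t` of triples of one-forms on `S`. -/
structure Family (S : Type*) [TopologicalSpace S] [ChartedSpace (EuclideanSpace ℝ (Fin 3)) S] where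
  β : ℝ → S → ℝ
  eu : ℝ → ∀ p : S, TangentSpace (𝓡 3) p →L[ℝ] ℝ
  el : ℝ → ∀ p : S, TangentSpace (𝓡 3) p →L[ℝ] ℝ
  en : ℝ → ∀ p : S, TangentSpace (𝓡 3) p →L[ℝ] ℝ

variable {S : Type*} [TopologicalSpace S] [ChartedSpace (EuclideanSpace ℝ (Fin 3)) S]

namespace Family

variable (F : Family S)

/-- The metric `h_t = e_u ⊗ e_u + e_l ⊗ e_l + e_n ⊗ e_n`. -/
def h (t : ℝ) (p : S) : TangentSpace (𝓡 3) p →L[ℝ] TangentSpace (𝓡 3) p →L[ℝ] ℝ :=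
  tensor (F.eu t p) (F.eu t p) + tensor (F.el t p) (F.el t p) + tensor (F.en t p) (F.en t p)

/-- The second fundamental form `Θ_t = -(1 / (2 β_t)) ∂_t h_t`. -/
def Θ (t : ℝ) (p : S) : TangentSpace (𝓡 3) p →L[ℝ] TangentSpace (𝓡 3) p →L[ℝ] ℝ :=
  (-(1 / (2 * F.β t p))) • deriv (fun s => F.h s p) t

/-- The covector `Θ_t(α) = Θ_t(α^♯, ·)`. -/
def ΘOf (t : ℝ) (p : S) (α : TangentSpace (𝓡 3) p →L[ℝ] ℝ) : TangentSpace (𝓡 3) p →L[ℝ] ℝ :=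
  F.Θ t p (sharp (F.h t p) α)

/-- The covector `dβ_t`. -/
def dβ (t : ℝ) (p : S) : TangentSpace (𝓡 3) p →L[ℝ] ℝ :=
  mvfderiv (𝓡 3) (F.β t) p

/-- The number `dβ_t(α) = dβ_t(α^♯)`. -/
def dβOf (t : ℝ) (p : S) (α : TangentSpace (𝓡 3) p →L[ℝ] ℝ) : ℝ :=
  F.dβ t p (sharp (F.h t p) α)

/-- The Hamiltonian function `R_{h_t} - |Θ_t|² + (Tr Θ_t)² + 6 λ²`. -/
def hamiltonian (lam t : ℝ) (p : S) : ℝ :=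
  scalarCurv (𝓡 3) basis3 (F.h t) p - normSqWrt (F.h t p) (F.Θ t p)
    + traceWrt (F.h t p) (F.Θ t p) ^ 2 + 6 * lam ^ 2

/-- The one-form `dt` on `ℝ × S`. -/
def dt (q : ℝ × S) : TangentSpace (𝓘(ℝ, ℝ).prod (𝓡 3)) q →L[ℝ] ℝ :=
  mvfderiv (𝓘(ℝ, ℝ).prod (𝓡 3)) (Prod.fst : ℝ × S → ℝ) q

/-- The pullback to `(t, p) ∈ ℝ × S` of a covector of `S` at `p`. -/
def lift (q : ℝ × S) (α : TangentSpace (𝓡 3) q.2 →L[ℝ] ℝ) :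
    TangentSpace (𝓘(ℝ, ℝ).prod (𝓡 3)) q →L[ℝ] ℝ :=
  α ∘L mfderiv (𝓘(ℝ, ℝ).prod (𝓡 3)) (𝓡 3) (Prod.snd : ℝ × S → S) q

/-- The Lorentzian metric `g = -β_t² dt ⊗ dt + h_t`. -/
def g (q : ℝ × S) : TangentSpace (𝓘(ℝ, ℝ).prod (𝓡 3)) q →L[ℝ]
    TangentSpace (𝓘(ℝ, ℝ).prod (𝓡 3)) q →L[ℝ] ℝ :=
  (-(F.β q.1 q.2 ^ 2)) • tensor (dt q) (dt q)
    + tensor (lift q (F.eu q.1 q.2)) (lift q (F.eu q.1 q.2))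
    + tensor (lift q (F.el q.1 q.2)) (lift q (F.el q.1 q.2))
    + tensor (lift q (F.en q.1 q.2)) (lift q (F.en q.1 q.2))

/-- The one-form `u = e^{f_t} (β_t dt + e_u^t)`. -/
def u (f : ℝ → S → ℝ) (q : ℝ × S) : TangentSpace (𝓘(ℝ, ℝ).prod (𝓡 3)) q →L[ℝ] ℝ :=
  Real.exp (f q.1 q.2) • (F.β q.1 q.2 • dt q + lift q (F.eu q.1 q.2))

end Family

/-- Joint smoothness on `J × S` of a family `(α_t)` of one-forms. -/
def SmoothOneForms [IsManifold (𝓡 3) ∞ S] (J : Set ℝ)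
    (α : ℝ → ∀ p : S, TangentSpace (𝓡 3) p →L[ℝ] ℝ) : Prop :=
  ContMDiffOn (𝓘(ℝ, ℝ).prod (𝓡 3)) ((𝓡 3).prod 𝓘(ℝ, EuclideanSpace ℝ (Fin 3) →L[ℝ] ℝ)) ∞
    (fun q : ℝ × S => TotalSpace.mk' (EuclideanSpace ℝ (Fin 3) →L[ℝ] ℝ)
      (E := fun p : S => TangentSpace (𝓡 3) p →L[ℝ] ℝ) q.2 (α q.1 q.2)) (J ×ˢ univ)

/-- Joint smoothness on `J × S` of a family `(f_t)` of functions. -/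
def SmoothFunctions (J : Set ℝ) (f : ℝ → S → ℝ) : Prop :=
  ContMDiffOn (𝓘(ℝ, ℝ).prod (𝓡 3)) 𝓘(ℝ, ℝ) ∞ (fun q : ℝ × S => f q.1 q.2) (J ×ˢ univ)

/-- The family `(β_t, e^t)_{t ∈ J}` is a real Killing spinorial flow with Killing constant `lam`:
a smooth family of positive functions and of coframes satisfying the real Killing spinorial flow
equations. Only `t ∈ J` matters. -/
structure IsKillingSpinorialFlow [IsManifold (𝓡 3) ∞ S] (lam : ℝ) (J : Set ℝ) (F : Family S) :
    Prop where
  smooth_β : SmoothFunctions J F.β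
  smooth_eu : SmoothOneForms J F.eu
  smooth_el : SmoothOneForms J F.el
  smooth_en : SmoothOneForms J F.en
  β_pos : ∀ t ∈ J, ∀ p, 0 < F.β t p
  coframe : ∀ t ∈ J, ∀ p, LinearIndependent ℝ ![F.eu t p, F.el t p, F.en t p]
  evol_eu : ∀ t ∈ J, ∀ p,
    deriv (fun s => F.eu s p) t + F.dβOf t p (F.eu t p) • F.eu t p
      + F.β t p • F.ΘOf t p (F.eu t p) = F.dβ t p + (lam * F.β t p) • F.el t p
  evol_el : ∀ t ∈ J, ∀ p,
    deriv (fun s => F.el s p) t + F.β t p • F.ΘOf t p (F.el t p)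
      = (-(F.dβOf t p (F.el t p) + lam * F.β t p)) • F.eu t p
  evol_en : ∀ t ∈ J, ∀ p,
    deriv (fun s => F.en s p) t + F.β t p • F.ΘOf t p (F.en t p)
      = (-(F.dβOf t p (F.en t p))) • F.eu t p
  evol_Θ : ∀ t ∈ J, ∀ p,
    deriv (fun s => F.ΘOf s p (F.eu s p)) t + lam • deriv (fun s => F.el s p) t
      = -(mvfderiv (𝓡 3) (fun q => F.dβOf t q (F.eu t q)) p)
  d_eu : ∀ t ∈ J, ∀ p, ∀ v w : TangentSpace (𝓡 3) p,
    extD (𝓡 3) (F.eu t) p v w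
      = wedge (F.ΘOf t p (F.eu t p) - lam • F.el t p) (F.eu t p) v w
  d_el : ∀ t ∈ J, ∀ p, ∀ v w : TangentSpace (𝓡 3) p,
    extD (𝓡 3) (F.el t) p v w = wedge (F.ΘOf t p (F.el t p)) (F.eu t p) v w
  d_en : ∀ t ∈ J, ∀ p, ∀ v w : TangentSpace (𝓡 3) p,
    extD (𝓡 3) (F.en t) p v w + lam * wedge (F.el t p) (F.en t p) v w
      = wedge (F.ΘOf t p (F.en t p)) (F.eu t p) v w
  exact_form : ∀ t ∈ J, ∃ φ : S → ℝ, ContMDiff (𝓡 3) 𝓘(ℝ, ℝ) ∞ φ ∧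
    ∀ p, mvfderiv (𝓡 3) φ p = F.ΘOf t p (F.eu t p) + lam • F.el t p

/-- The family of functions `(f_t)_{t ∈ J}` is smooth and satisfies
`d f_t = -Θ_t(e_u^t) - λ e_l^t` and `∂_t f_t = dβ_t(e_u^t)`. -/
structure IsPotential (lam : ℝ) (J : Set ℝ) (F : Family S) (f : ℝ → S → ℝ) : Prop where
  smooth : SmoothFunctions J f
  d_space : ∀ t ∈ J, ∀ p,
    mvfderiv (𝓡 3) (f t) p = -F.ΘOf t p (F.eu t p) - lam • F.el t p
  d_time : ∀ t ∈ J, ∀ p, deriv (fun s => f s p) t = F.dβOf t p (F.eu t p)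

end KillingFlow

end

open scoped Manifold ContDiff
open Bundle Set

noncomputable section

/-! The proof is Cartan's method of moving frames on `M`. Put θ⁰ = β dt, ν = θ⁰ + e_u and B_a =
Θ(e_a) - dβ(e_a) dt. The coframe (θ⁰, e_u, e_l, e_n) is orthonormal for `g`, and the equations for
∂_t e_a and de_a say that its Levi-Civita connection form is ψ⁰_a = ψ^a_0 = -B_a, ψ^u_l = B_l - λν,
ψ^u_n = B_n, ψ^l_n = λ e_n (`isLeviCivita4`).

A potential gives B_u = -df - λ e_l, so dB_u = -λ de_l. The second structure equation then shows
that Ω⁰_u and Ω^n_l are those of constant curvature -λ², while for a = l, n both Ω^a_0 and Ω^a_u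
differ from the constant curvature value by one and the same two-form Ξ^a (`excessForm`). The first
Bianchi identity gives Ξ^a ∧ ν = 0 and Ξ^l ∧ e_l + Ξ^n ∧ e_n = 0. After contraction only Ric = -3λ²
g + N ν ⊗ ν survives (`FlowInCoordinates.ricci_eq`). The Gauss equation on the slices of constant
time, contracted twice, identifies 2N with the Hamiltonian function (`two_mul_nullCoeff`), and u =
e^f ν accounts for the factor e^{-2f}.

For the existence of f, the one-form dβ(e_u) dt - Θ(e_u) - λ e_l is exact on a slice by hypothesis,
and the evolution equation of Θ(e_u) matches its mixed derivatives in time and space. Integrating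
dβ(e_u) in time from a primitive on one slice produces f (`exists_isPotential`).

Two bridges link this to the definitions. The Ricci tensor given by Christoffel symbols must be
expressed by the curvature form (`IsLeviCivita.ricciCoord_eq`), and the invariant equations on `S`
must be read in a fixed chart (`flowInCoordinates`). -/

namespace KillingFlow

/-! ### Cartan's structure equations and curvature in a moving frame. -/

section Cartan

open scoped Topology

variable {E : Type*} [NormedAddCommGroup E] [NormedSpace ℝ E]

/-- The exterior derivative of a one-form on a vector space. -/
def dForm (α : E → E →L[ℝ] ℝ) (x v w : E) : ℝ :=
  fderiv ℝ α x v w - fderiv ℝ α x w v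

theorem fderiv_form_apply {α : E → E →L[ℝ] ℝ} {x : E} (h : DifferentiableAt ℝ α x) (v u : E) :
    fderiv ℝ (fun y => α y v) x u = fderiv ℝ α x u v := by
  rw [fderiv_clm_apply h (differentiableAt_const v)]
  simp

theorem dForm_congr {α γ : E → E →L[ℝ] ℝ} {x : E} (h : α =ᶠ[𝓝 x] γ) (v w : E) :
    dForm α x v w = dForm γ x v w := by
  rw [dForm, dForm, h.fderiv_eq]

theorem dForm_add {α γ : E → E →L[ℝ] ℝ} {x : E} (hα : DifferentiableAt ℝ α x)
    (hγ : DifferentiableAt ℝ γ x) (v w : E) :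
    dForm (fun y => α y + γ y) x v w = dForm α x v w + dForm γ x v w := by
  rw [dForm, fderiv_fun_add hα hγ]
  simp only [dForm, add_apply]
  ring

theorem dForm_const_smul {α : E → E →L[ℝ] ℝ} {x : E} (hα : DifferentiableAt ℝ α x)
    (r : ℝ) (v w : E) : dForm (fun y => r • α y) x v w = r * dForm α x v w := by
  rw [dForm, fderiv_fun_const_smul hα]
  simp only [dForm, smul_apply, smul_eq_mul]
  ring

theorem dForm_neg (α : E → E →L[ℝ] ℝ) (x v w : E) :
    dForm (fun y => -α y) x v w = -dForm α x v w := by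
  rw [dForm, fderiv_fun_neg]
  simp only [dForm, neg_apply]
  ring

theorem dForm_fderiv {f : E → ℝ} {x : E} (hf : ContDiffAt ℝ 2 f x) (v w : E) :
    dForm (fderiv ℝ f) x v w = 0 := by
  rw [dForm, (hf.isSymmSndFDerivAt (by simp)) v w, sub_self]

variable {ι : Type*} [Fintype ι]

/-- The curvature form `dψ^a_c + ∑_b ψ^a_b ∧ ψ^b_c`. -/
def curvForm (ψ : ι → ι → E → E →L[ℝ] ℝ) (a c : ι) (x v w : E) : ℝ :=
  dForm (ψ a c) x v w + ∑ d, (ψ a d x v * ψ d c x w - ψ a d x w * ψ d c x v)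

/-- The curvature form is antisymmetric. -/
theorem curvForm_swap (ψ : ι → ι → E → E →L[ℝ] ℝ) (a c : ι) (x v w : E) :
    curvForm ψ a c x v w = -curvForm ψ a c x w v := by
  simp only [curvForm, dForm, Finset.sum_sub_distrib]
  ring

/-- The curvature form as a linear function of its second argument. -/
def curvLin (ψ : ι → ι → E → E →L[ℝ] ℝ) (a c : ι) (x v : E) : E →ₗ[ℝ] ℝ :=
  (fderiv ℝ (ψ a c) x v : E →ₗ[ℝ] ℝ) - ((fderiv ℝ (ψ a c) x).flip v : E →ₗ[ℝ] ℝ)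
    + ∑ d, (ψ a d x v • (ψ d c x : E →ₗ[ℝ] ℝ) - ψ d c x v • (ψ a d x : E →ₗ[ℝ] ℝ))

theorem curvLin_apply (ψ : ι → ι → E → E →L[ℝ] ℝ) (a c : ι) (x v w : E) :
    curvLin ψ a c x v w = curvForm ψ a c x v w := by
  simp [curvLin, curvForm, dForm, mul_comm]

theorem curvForm_sum_right (ψ : ι → ι → E → E →L[ℝ] ℝ) (a c : ι) (x v : E) {κ : Type*}
    (s : Finset κ) (r : κ → ℝ) (y : κ → E) :
    curvForm ψ a c x v (∑ k ∈ s, r k • y k) = ∑ k ∈ s, r k * curvForm ψ a c x v (y k) := by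
  simp [← curvLin_apply]

theorem curvForm_sum_left (ψ : ι → ι → E → E →L[ℝ] ℝ) (a c : ι) (x w : E) {κ : Type*}
    (s : Finset κ) (r : κ → ℝ) (y : κ → E) :
    curvForm ψ a c x (∑ k ∈ s, r k • y k) w = ∑ k ∈ s, r k * curvForm ψ a c x (y k) w := by
  rw [curvForm_swap, curvForm_sum_right, ← Finset.sum_neg_distrib]
  exact Finset.sum_congr rfl fun k _ => by rw [curvForm_swap ψ a c x w]; ring

variable [DecidableEq ι]

/-- On the open set `U`, `θ` is a coframe, orthonormal with signs `ε`, dual to the frame `X`,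
and `ψ` is its Levi-Civita connection form. -/
structure IsLeviCivita (ε : ι → ℝ) (θ : ι → E → E →L[ℝ] ℝ) (X : ι → E → E)
    (ψ : ι → ι → E → E →L[ℝ] ℝ) (U : Set E) : Prop where
  isOpen : IsOpen U
  sign : ∀ a, ε a * ε a = 1
  smooth_θ : ∀ a, ContDiffOn ℝ 2 (θ a) U
  smooth_X : ∀ a, ContDiffOn ℝ 1 (X a) U
  smooth_ψ : ∀ a c, ContDiffOn ℝ 1 (ψ a c) U
  dual : ∀ x ∈ U, ∀ a c, θ a x (X c x) = if a = c then 1 else 0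
  torsion : ∀ x ∈ U, ∀ a v w,
    dForm (θ a) x v w = -∑ c, (ψ a c x v * θ c x w - ψ a c x w * θ c x v)
  skew : ∀ x ∈ U, ∀ a c v, ε a * ψ a c x v = -(ε c * ψ c a x v)

namespace IsLeviCivita

variable {ε : ι → ℝ} {θ : ι → E → E →L[ℝ] ℝ} {X : ι → E → E} {ψ : ι → ι → E → E →L[ℝ] ℝ}
  {U : Set E} (h : IsLeviCivita ε θ X ψ U) {x : E} (hx : x ∈ U)
include h hx

theorem contDiffAt_θ (a : ι) : ContDiffAt ℝ 2 (θ a) x :=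
  (h.smooth_θ a).contDiffAt (h.isOpen.mem_nhds hx)

theorem differentiableAt_θ (a : ι) : DifferentiableAt ℝ (θ a) x :=
  (h.contDiffAt_θ hx a).differentiableAt (by norm_num)

theorem differentiableAt_fderiv_θ (a : ι) : DifferentiableAt ℝ (fderiv ℝ (θ a)) x :=
  ((h.contDiffAt_θ hx a).fderiv_right (m := 1) (by norm_num)).differentiableAt (by norm_num)

theorem differentiableAt_ψ (a c : ι) : DifferentiableAt ℝ (ψ a c) x :=
  ((h.smooth_ψ a c).contDiffAt (h.isOpen.mem_nhds hx)).differentiableAt (by norm_num)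

theorem differentiableAt_X (a : ι) : DifferentiableAt ℝ (X a) x :=
  ((h.smooth_X a).contDiffAt (h.isOpen.mem_nhds hx)).differentiableAt (by norm_num)

theorem sndDeriv_symm (a : ι) (u v : E) :
    fderiv ℝ (fderiv ℝ (θ a)) x u v = fderiv ℝ (fderiv ℝ (θ a)) x v u :=
  ((h.contDiffAt_θ hx a).isSymmSndFDerivAt (by simp)) u v

theorem fderiv_fderiv_apply (a : ι) (u v w : E) :
    fderiv ℝ (fun y => fderiv ℝ (θ a) y v w) x u = fderiv ℝ (fderiv ℝ (θ a)) x u v w := by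
  have h1 := h.differentiableAt_fderiv_θ hx a
  have h2 : DifferentiableAt ℝ (fun y => fderiv ℝ (θ a) y v) x :=
    h1.clm_apply (differentiableAt_const v)
  rw [fderiv_clm_apply h2 (differentiableAt_const w), fderiv_clm_apply h1 (differentiableAt_const v)]
  simp

/-- The derivative of `ψ^a_c(v) θ^c(w)`. -/
theorem fderiv_ψ_mul_θ (a c : ι) (u v w : E) :
    fderiv ℝ (fun y => ψ a c y v * θ c y w) x u
      = fderiv ℝ (ψ a c) x u v * θ c x w + ψ a c x v * fderiv ℝ (θ c) x u w := by
  have h1 : DifferentiableAt ℝ (fun y => ψ a c y v) x :=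
    (h.differentiableAt_ψ hx a c).clm_apply (differentiableAt_const v)
  have h2 : DifferentiableAt ℝ (fun y => θ c y w) x :=
    (h.differentiableAt_θ hx c).clm_apply (differentiableAt_const w)
  rw [fderiv_fun_mul h1 h2]
  simp only [add_apply, smul_apply, smul_eq_mul,
    fderiv_form_apply (h.differentiableAt_ψ hx a c), fderiv_form_apply (h.differentiableAt_θ hx c)]
  ring

theorem differentiableAt_ψ_mul_θ (a c : ι) (v w : E) :
    DifferentiableAt ℝ (fun y => ψ a c y v * θ c y w) x :=
  ((h.differentiableAt_ψ hx a c).clm_apply (differentiableAt_const v)).mul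
    ((h.differentiableAt_θ hx c).clm_apply (differentiableAt_const w))

/-- The covariant derivative of the coframe with respect to the flat connection and `ψ`. -/
theorem fderiv_sum_ψ_mul_θ (a : ι) (u v w : E) :
    fderiv ℝ (fun y => ∑ c, ψ a c y v * θ c y w) x u
      = ∑ c, (fderiv ℝ (ψ a c) x u v * θ c x w + ψ a c x v * fderiv ℝ (θ c) x u w) := by
  rw [fderiv_fun_sum fun c _ => h.differentiableAt_ψ_mul_θ hx a c v w]
  simp [h.fderiv_ψ_mul_θ hx]

/-- Differentiation preserves the skewness of ψ with respect to the signs ε. In the quadratic term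
skewness is applied to both factors, so the two signs cancel and the order of the wedge product is
reversed. -/
theorem curvForm_skew (a c : ι) (v w : E) :
    ε a * curvForm ψ a c x v w = -(ε c * curvForm ψ c a x v w) := by
  have d1 : ε a * dForm (ψ a c) x v w = -(ε c * dForm (ψ c a) x v w) := by
    rw [← dForm_const_smul (h.differentiableAt_ψ hx a c),
      ← dForm_const_smul (h.differentiableAt_ψ hx c a), ← dForm_neg]
    refine dForm_congr ?_ v w
    filter_upwards [h.isOpen.mem_nhds hx] with y hy
    ext z
    simpa using h.skew y hy a c z
  have d2 : ∀ d, ε a * (ψ a d x v * ψ d c x w) = ε c * (ψ c d x w * ψ d a x v) := by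
    intro d
    linear_combination ψ d c x w * h.skew x hx a d v - ψ d a x v * h.skew x hx c d w
  have d3 : ∀ d, ε a * (ψ a d x w * ψ d c x v) = ε c * (ψ c d x v * ψ d a x w) := by
    intro d
    linear_combination ψ d c x v * h.skew x hx a d w - ψ d a x w * h.skew x hx c d v
  simp only [curvForm, mul_add, d1, Finset.mul_sum, mul_sub, d2, d3, neg_add,
    ← Finset.sum_neg_distrib, neg_sub]

/-- The first Bianchi identity. -/
theorem bianchi (a : ι) (u v w : E) :
    ∑ c, (curvForm ψ a c x u v * θ c x w + curvForm ψ a c x v w * θ c x u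
      + curvForm ψ a c x w u * θ c x v) = 0 := by
  -- This is the derivative in the direction u of the torsion equation evaluated on constant fields
  -- v, w. In the cyclic sum over u, v, w the left-hand sides cancel, because second derivatives of
  -- θ are symmetric.
  have key : ∀ u v w : E,
      fderiv ℝ (fderiv ℝ (θ a)) x u v w - fderiv ℝ (fderiv ℝ (θ a)) x u w v
        = -∑ c, (fderiv ℝ (ψ a c) x u v * θ c x w + ψ a c x v * fderiv ℝ (θ c) x u w)
          + ∑ c, (fderiv ℝ (ψ a c) x u w * θ c x v + ψ a c x w * fderiv ℝ (θ c) x u v) := by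
    intro u v w
    have e : (fun y => fderiv ℝ (θ a) y v w - fderiv ℝ (θ a) y w v) =ᶠ[𝓝 x]
        fun y => -(∑ c, ψ a c y v * θ c y w) + ∑ c, ψ a c y w * θ c y v := by
      filter_upwards [h.isOpen.mem_nhds hx] with y hy
      have := h.torsion y hy a v w
      rw [dForm, Finset.sum_sub_distrib] at this
      rw [this]; ring
    have e2 := congrArg (fun L : E →L[ℝ] ℝ => L u) e.fderiv_eq
    have hd : ∀ v w : E, DifferentiableAt ℝ (fun y => fderiv ℝ (θ a) y v w) x := fun v w =>
      ((h.differentiableAt_fderiv_θ hx a).clm_apply (differentiableAt_const v)).clm_apply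
        (differentiableAt_const w)
    have hs : ∀ v w : E, DifferentiableAt ℝ (fun y => ∑ c, ψ a c y v * θ c y w) x := fun v w =>
      DifferentiableAt.fun_sum fun c _ => h.differentiableAt_ψ_mul_θ hx a c v w
    rw [fderiv_fun_sub (hd v w) (hd w v), fderiv_fun_add (hs v w).fun_neg (hs w v),
      fderiv_fun_neg] at e2
    simpa [h.fderiv_fderiv_apply hx, h.fderiv_sum_ψ_mul_θ hx] using e2
  have tor : ∀ v w : E, ∀ c, fderiv ℝ (θ c) x v w
      = fderiv ℝ (θ c) x w v - ∑ d, (ψ c d x v * θ d x w - ψ c d x w * θ d x v) := by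
    intro v w c
    have := h.torsion x hx c v w
    rw [dForm] at this
    linarith
  have k1 := key u v w
  have k2 := key v w u
  have k3 := key w u v
  rw [h.sndDeriv_symm hx a v u] at k2
  rw [h.sndDeriv_symm hx a w u, h.sndDeriv_symm hx a w v] at k3
  -- Reassociation: the torsion term substituted under ψ^a_c becomes the quadratic part of the
  -- curvature.
  have sw : ∀ u v w : E, ∑ c, ψ a c x u * ∑ d, (ψ c d x v * θ d x w - ψ c d x w * θ d x v)
      = ∑ d, ((∑ c, ψ a c x u * ψ c d x v) * θ d x w - (∑ c, ψ a c x u * ψ c d x w) * θ d x v) := by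
    intro u v w
    simp only [Finset.mul_sum, Finset.sum_mul, mul_sub, ← Finset.sum_sub_distrib, ← mul_assoc]
    rw [Finset.sum_comm]
  have s1 := sw v u w
  have s2 := sw w v u
  have s3 := sw u w v
  simp only [curvForm, dForm, Finset.sum_sub_distrib, add_mul, sub_mul, Finset.sum_add_distrib]
    at *
  -- Each antisymmetrised first derivative of θ left in the cyclic sum is traded for a term in ψ ∧ θ
  -- by the torsion equation.
  have t1 : ∑ c, ψ a c x v * fderiv ℝ (θ c) x u w = ∑ c, ψ a c x v * fderiv ℝ (θ c) x w u
      - ∑ c, ψ a c x v * (∑ d, ψ c d x u * θ d x w - ∑ d, ψ c d x w * θ d x u) := by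
    rw [← Finset.sum_sub_distrib]
    exact Finset.sum_congr rfl fun c _ => by rw [tor u w c]; ring
  have t2 : ∑ c, ψ a c x w * fderiv ℝ (θ c) x v u = ∑ c, ψ a c x w * fderiv ℝ (θ c) x u v
      - ∑ c, ψ a c x w * (∑ d, ψ c d x v * θ d x u - ∑ d, ψ c d x u * θ d x v) := by
    rw [← Finset.sum_sub_distrib]
    exact Finset.sum_congr rfl fun c _ => by rw [tor v u c]; ring
  have t3 : ∑ c, ψ a c x u * fderiv ℝ (θ c) x w v = ∑ c, ψ a c x u * fderiv ℝ (θ c) x v w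
      - ∑ c, ψ a c x u * (∑ d, ψ c d x w * θ d x v - ∑ d, ψ c d x v * θ d x w) := by
    rw [← Finset.sum_sub_distrib]
    exact Finset.sum_congr rfl fun c _ => by rw [tor w v c]; ring
  linarith

/-! ### Christoffel symbols, Riemann, Ricci and scalar curvature from the connection form. -/

/-- The matrix of the components of the frame is inverse to the matrix of the components of the
coframe. -/
theorem frame_mul_coframe (b : Module.Basis ι ℝ E) :
    (Matrix.of fun k a => b.repr (X a x) k) * (Matrix.of fun a i => θ a x (b i)) = 1 := by
  -- Duality is the product in the other order. For square matrices a one-sided inverse is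
  -- two-sided.
  apply mul_eq_one_comm.mp
  ext a c
  rw [Matrix.mul_apply, Matrix.one_apply, ← h.dual x hx a c]
  conv_rhs => rw [← b.sum_repr (X c x), map_sum]
  simp [mul_comm]

/-- The inverse metric in terms of the frame. -/
theorem inv_metric (b : Module.Basis ι ℝ E) {g : Matrix ι ι ℝ}
    (hg : ∀ i j, g i j = ∑ a, ε a * (θ a x (b i) * θ a x (b j))) :
    g⁻¹ = (Matrix.of fun k a => b.repr (X a x) k) * Matrix.diagonal ε
      * (Matrix.of fun k a => b.repr (X a x) k).transpose := by
  apply Matrix.inv_eq_right_inv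
  have e : g = (Matrix.of fun a i => θ a x (b i)).transpose * Matrix.diagonal ε
      * (Matrix.of fun a i => θ a x (b i)) := by
    ext i j
    rw [hg, Matrix.mul_apply]
    simp [Matrix.mul_diagonal]
    exact Finset.sum_congr rfl fun a _ => by ring
  have h1 := h.frame_mul_coframe hx b
  have h2 := mul_eq_one_comm.mp h1
  have h3 := congrArg Matrix.transpose h1
  rw [Matrix.transpose_mul, Matrix.transpose_one] at h3
  have h4 : Matrix.diagonal ε * Matrix.diagonal ε = 1 := by
    rw [Matrix.diagonal_mul_diagonal, ← Matrix.diagonal_one]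
    congr 1; ext a; exact h.sign a
  rw [e]
  simp only [Matrix.mul_assoc]
  rw [← Matrix.mul_assoc (Matrix.of fun a i => θ a x (b i)) (Matrix.of fun k a => b.repr (X a x) k),
    h2, Matrix.one_mul, ← Matrix.mul_assoc (Matrix.diagonal ε), h4, Matrix.one_mul, h3]

omit hx in
/-- The Christoffel symbols in terms of the connection form. -/
theorem christoffel_eq (b : Module.Basis ι ℝ E) {G : E → Matrix ι ι ℝ}
    (hG : ∀ y ∈ U, ∀ i j, G y i j = ∑ a, ε a * (θ a y (b i) * θ a y (b j)))
    {x : E} (hx : x ∈ U) (k i j : ι) :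
    christoffel b G k i j x = ∑ a, b.repr (X a x) k
      * (fderiv ℝ (θ a) x (b i) (b j) + ∑ c, ψ a c x (b i) * θ c x (b j)) := by
  -- C^a_ij is the component θ^a(∇_i ∂_j). Its symmetry in i, j is the vanishing of the torsion.
  set C : ι → ι → ι → ℝ := fun a i j =>
    fderiv ℝ (θ a) x (b i) (b j) + ∑ c, ψ a c x (b i) * θ c x (b j) with hC
  have Csymm : ∀ a i j, C a i j = C a j i := by
    intro a i j
    have := h.torsion x hx a (b i) (b j)
    rw [dForm, Finset.sum_sub_distrib] at this
    simp only [hC]; linarith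
  have dG : ∀ i j l, partialD b i (fun y => G y j l) x
      = ∑ a, ε a * (C a i j * θ a x (b l) + θ a x (b j) * C a i l) := by
    intro i j l
    have e : (fun y => G y j l) =ᶠ[𝓝 x] fun y => ∑ a, ε a * (θ a y (b j) * θ a y (b l)) := by
      filter_upwards [h.isOpen.mem_nhds hx] with y hy using hG y hy j l
    have d1 : ∀ a j, DifferentiableAt ℝ (fun y => θ a y (b j)) x := fun a j =>
      (h.differentiableAt_θ hx a).clm_apply (differentiableAt_const _)
    have d2 : partialD b i (fun y => G y j l) x
        = ∑ a, ε a * (fderiv ℝ (θ a) x (b i) (b j) * θ a x (b l)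
            + θ a x (b j) * fderiv ℝ (θ a) x (b i) (b l)) := by
      rw [partialD, e.fderiv_eq,
        fderiv_fun_sum fun a _ => ((d1 a j).fun_mul (d1 a l)).const_mul (ε a)]
      simp only [sum_apply]
      refine Finset.sum_congr rfl fun a _ => ?_
      rw [fderiv_const_mul ((d1 a j).fun_mul (d1 a l)), fderiv_fun_mul (d1 a j) (d1 a l)]
      simp only [add_apply, smul_apply, smul_eq_mul,
        fderiv_form_apply (h.differentiableAt_θ hx a)]
      ring
    -- Metric compatibility: skewness of ψ lets C replace the bare derivative of θ in the derivative
    -- of the metric.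
    have cross : ∑ a, ε a * ((∑ c, ψ a c x (b i) * θ c x (b j)) * θ a x (b l)
        + θ a x (b j) * ∑ c, ψ a c x (b i) * θ c x (b l)) = 0 := by
      simp only [mul_add, Finset.sum_add_distrib, Finset.mul_sum, Finset.sum_mul]
      rw [Finset.sum_comm, ← Finset.sum_add_distrib]
      refine Finset.sum_eq_zero fun c _ => ?_
      rw [← Finset.sum_add_distrib]
      refine Finset.sum_eq_zero fun a _ => ?_
      linear_combination (θ c x (b j) * θ a x (b l)) * h.skew x hx a c (b i)
    rw [d2, ← add_zero (∑ a, _), ← cross, ← Finset.sum_add_distrib]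
    refine Finset.sum_congr rfl fun a _ => ?_
    simp only [hC]; ring
  have Gθ : ∀ a, ∑ l, (G x)⁻¹ k l * (ε a * θ a x (b l)) = b.repr (X a x) k := by
    intro a
    have h1 : (G x)⁻¹ * (Matrix.of fun a i => θ a x (b i)).transpose
        = (Matrix.of fun k a => b.repr (X a x) k) * Matrix.diagonal ε := by
      have h2 := mul_eq_one_comm.mp (h.frame_mul_coframe hx b)
      have h3 := congrArg Matrix.transpose h2
      rw [Matrix.transpose_mul, Matrix.transpose_one] at h3
      rw [h.inv_metric hx b (hG x hx), Matrix.mul_assoc, h3, Matrix.mul_one]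
    have h4 := congrFun (congrFun h1 k) a
    rw [Matrix.mul_apply, Matrix.mul_diagonal] at h4
    simp only [Matrix.transpose_apply, Matrix.of_apply] at h4
    calc _ = (∑ l, (G x)⁻¹ k l * θ a x (b l)) * ε a := by
          rw [Finset.sum_mul]; exact Finset.sum_congr rfl fun l _ => by ring
      _ = _ := by rw [h4, mul_assoc, h.sign a, mul_one]
  -- Koszul's computation: of the six terms four cancel by symmetry of C, and the other two agree.
  have br : ∀ l, partialD b i (fun y => G y j l) x + partialD b j (fun y => G y i l) x
      - partialD b l (fun y => G y i j) x = ∑ a, 2 * (C a i j * (ε a * θ a x (b l))) := by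
    intro l
    rw [dG, dG, dG, ← Finset.sum_add_distrib, ← Finset.sum_sub_distrib]
    refine Finset.sum_congr rfl fun a _ => ?_
    rw [Csymm a j i, Csymm a l i, Csymm a l j]; ring
  rw [christoffel]
  simp only [br, Finset.mul_sum]
  rw [Finset.sum_comm]
  refine Finset.sum_congr rfl fun a _ => ?_
  rw [← Gθ a, Finset.sum_mul]
  exact Finset.sum_congr rfl fun l _ => by ring

omit hx in
/-- The Riemann tensor in terms of the curvature form. -/
theorem riemann_eq (b : Module.Basis ι ℝ E) {G : E → Matrix ι ι ℝ}
    (hG : ∀ y ∈ U, ∀ i j, G y i j = ∑ a, ε a * (θ a y (b i) * θ a y (b j)))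
    {x : E} (hx : x ∈ U) (k m i j : ι) :
    partialD b m (christoffel b G k i j) x - partialD b i (christoffel b G k m j) x
      + ∑ l, (christoffel b G k m l x * christoffel b G l i j x
        - christoffel b G k i l x * christoffel b G l m j x)
    = ∑ a, ∑ c, b.repr (X a x) k * (curvForm ψ a c x (b m) (b i) * θ c x (b j)) := by
  -- Differentiability is read off the moving frame formula, where the coframe enters through at
  -- most one derivative; hence C² is enough.
  have dΓ : ∀ k i j, DifferentiableAt ℝ (christoffel b G k i j) x := by
    intro k i j
    have e : christoffel b G k i j =ᶠ[𝓝 x] fun x => ∑ a, b.repr (X a x) k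
        * (fderiv ℝ (θ a) x (b i) (b j) + ∑ c, ψ a c x (b i) * θ c x (b j)) := by
      filter_upwards [h.isOpen.mem_nhds hx] with y hy using h.christoffel_eq b hG hy k i j
    refine DifferentiableAt.congr_of_eventuallyEq ?_ e
    have : FiniteDimensional ℝ E := Module.Basis.finiteDimensional_of_finite b
    refine DifferentiableAt.fun_sum fun a _ => DifferentiableAt.fun_mul ?_
      (DifferentiableAt.fun_add ?_ (DifferentiableAt.fun_sum fun c _ =>
        h.differentiableAt_ψ_mul_θ hx a c _ _))
    · exact (LinearMap.toContinuousLinearMap (b.coord k)).differentiableAt.comp x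
        (h.differentiableAt_X hx a)
    · exact ((h.differentiableAt_fderiv_θ hx a).clm_apply (differentiableAt_const _)).clm_apply
        (differentiableAt_const _)
  have θΓ : ∀ y ∈ U, ∀ a i j, ∑ k, θ a y (b k) * christoffel b G k i j y
      = fderiv ℝ (θ a) y (b i) (b j) + ∑ c, ψ a c y (b i) * θ c y (b j) := by
    intro y hy a i j
    simp only [h.christoffel_eq b hG hy, Finset.mul_sum]
    rw [Finset.sum_comm]
    have h2 := mul_eq_one_comm.mp (h.frame_mul_coframe hy b)
    have h3 : ∀ c, ∑ k, θ a y (b k) * b.repr (X c y) k = if a = c then 1 else 0 := fun c => by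
      simpa [Matrix.mul_apply, Matrix.one_apply] using congrFun (congrFun h2 a) c
    simp only [← mul_assoc, ← Finset.sum_mul, h3]
    simp
  -- In matrix form Γ_i and W_i are one connection in the coordinate frame and in the moving frame,
  -- related by the gauge transformation Th Γ_i = ∂_i Th + W_i Th. Differentiating it once more and
  -- antisymmetrising shows that the curvatures are conjugate by Th.
  set Th : Matrix ι ι ℝ := Matrix.of fun a i => θ a x (b i)
  set P : Matrix ι ι ℝ := Matrix.of fun k a => b.repr (X a x) k
  set Γ : ι → Matrix ι ι ℝ := fun i => Matrix.of fun k j => christoffel b G k i j x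
  set W : ι → Matrix ι ι ℝ := fun i => Matrix.of fun a c => ψ a c x (b i)
  set dTh : ι → Matrix ι ι ℝ := fun m => Matrix.of fun a i => fderiv ℝ (θ a) x (b m) (b i)
  set dΓm : ι → ι → Matrix ι ι ℝ := fun m i => Matrix.of fun k j =>
    partialD b m (christoffel b G k i j) x with hdΓm
  set dW : ι → ι → Matrix ι ι ℝ := fun m i => Matrix.of fun a c =>
    fderiv ℝ (ψ a c) x (b m) (b i)
  set d2 : ι → ι → Matrix ι ι ℝ := fun m i => Matrix.of fun a j =>
    fderiv ℝ (fderiv ℝ (θ a)) x (b m) (b i) (b j)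
  have d2symm : d2 m i = d2 i m := by
    ext a j
    exact congrArg (fun L : E →L[ℝ] ℝ => L (b j)) (h.sndDeriv_symm hx a (b m) (b i))
  have e1 : ∀ i, Th * Γ i = dTh i + W i * Th := by
    intro i; ext a j
    simpa [Matrix.mul_apply, Th, Γ, dTh, W] using θΓ x hx a i j
  have e2 : ∀ m i, dTh m * Γ i + Th * dΓm m i = d2 m i + dW m i * Th + W i * dTh m := by
    intro m i; ext a j
    have ev : (fun y => ∑ k, θ a y (b k) * christoffel b G k i j y) =ᶠ[𝓝 x]
        fun y => fderiv ℝ (θ a) y (b i) (b j) + ∑ c, ψ a c y (b i) * θ c y (b j) := by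
      filter_upwards [h.isOpen.mem_nhds hx] with y hy using θΓ y hy a i j
    have ev2 := congrArg (fun L : E →L[ℝ] ℝ => L (b m)) ev.fderiv_eq
    have d1 : ∀ a j, DifferentiableAt ℝ (fun y => θ a y (b j)) x := fun a j =>
      (h.differentiableAt_θ hx a).clm_apply (differentiableAt_const _)
    rw [fderiv_fun_sum fun k _ => (d1 a k).fun_mul (dΓ k i j), fderiv_fun_add
      (((h.differentiableAt_fderiv_θ hx a).clm_apply (differentiableAt_const _)).clm_apply
        (differentiableAt_const _))
      (DifferentiableAt.fun_sum fun c _ => h.differentiableAt_ψ_mul_θ hx a c _ _)] at ev2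
    simp only [add_apply, sum_apply, h.fderiv_sum_ψ_mul_θ hx, h.fderiv_fderiv_apply hx,
      fderiv_fun_mul (d1 a _) (dΓ _ i j), smul_apply, smul_eq_mul,
      fderiv_form_apply (h.differentiableAt_θ hx a), Finset.sum_add_distrib] at ev2
    simp only [Matrix.add_apply, Matrix.mul_apply, Th, Γ, dTh, W, dW, d2, dΓm, Matrix.of_apply,
      partialD, ← Finset.sum_add_distrib] at ev2 ⊢
    rw [add_assoc, ← Finset.sum_add_distrib, ← ev2]
    exact Finset.sum_congr rfl fun k _ => by ring
  have e3 : Th * (dΓm m i - dΓm i m + (Γ m * Γ i - Γ i * Γ m))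
      = (dW m i - dW i m + (W m * W i - W i * W m)) * Th := by
    have f1 := e2 m i
    have f2 := e2 i m
    have g : ∀ m i, Th * (Γ m * Γ i) = dTh m * Γ i + W m * (dTh i + W i * Th) := by
      intro m i
      rw [← Matrix.mul_assoc, e1 m, Matrix.add_mul, Matrix.mul_assoc, e1 i]
    rw [Matrix.mul_add, Matrix.mul_sub, Matrix.mul_sub, g, g, eq_sub_of_add_eq' f1,
      eq_sub_of_add_eq' f2, d2symm]
    noncomm_ring
  have e4 : dΓm m i - dΓm i m + (Γ m * Γ i - Γ i * Γ m)
      = P * ((dW m i - dW i m + (W m * W i - W i * W m)) * Th) := by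
    rw [← e3, ← Matrix.mul_assoc, h.frame_mul_coframe hx b, Matrix.one_mul]
  have e5 := congrFun (congrFun e4 k) j
  have hΩ : ∀ a c, (dW m i - dW i m + (W m * W i - W i * W m)) a c
      = curvForm ψ a c x (b m) (b i) := by
    intro a c
    simp [curvForm, dForm, Matrix.mul_apply, dW, W, Finset.sum_sub_distrib]
  rw [Matrix.mul_apply] at e5
  simp only [Matrix.mul_apply (M := dW m i - dW i m + (W m * W i - W i * W m)), hΩ] at e5
  simpa [Matrix.mul_apply, Γ, dΓm, P, Th, Finset.mul_sum, Finset.sum_sub_distrib] using e5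

omit hx in
/-- The Ricci tensor in terms of the curvature form. -/
theorem ricciCoord_eq (b : Module.Basis ι ℝ E) {G : E → Matrix ι ι ℝ}
    (hG : ∀ y ∈ U, ∀ i j, G y i j = ∑ a, ε a * (θ a y (b i) * θ a y (b j)))
    {x : E} (hx : x ∈ U) (i j : ι) :
    ricciCoord b G i j x = ∑ a, ∑ c, curvForm ψ a c x (X a x) (b i) * θ c x (b j) := by
  simp only [ricciCoord, h.riemann_eq b hG hx]
  rw [Finset.sum_comm]
  refine Finset.sum_congr rfl fun a _ => ?_
  rw [Finset.sum_comm]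
  refine Finset.sum_congr rfl fun c _ => ?_
  conv_rhs => rw [← b.sum_repr (X a x), curvForm_sum_left, Finset.sum_mul]
  exact Finset.sum_congr rfl fun k _ => by ring

-- Contracting with arbitrary vectors removes the basis `b`, so the right-hand side is the Ricci
-- tensor in frame terms alone.
omit hx in
theorem sum_ricciCoord_eq (b : Module.Basis ι ℝ E) {G : E → Matrix ι ι ℝ}
    (hG : ∀ y ∈ U, ∀ i j, G y i j = ∑ a, ε a * (θ a y (b i) * θ a y (b j)))
    {x : E} (hx : x ∈ U) (v w : E) :
    ∑ i, ∑ j, b.repr v i * b.repr w j * ricciCoord b G i j x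
      = ∑ a, ∑ c, curvForm ψ a c x (X a x) v * θ c x w := by
  simp only [h.ricciCoord_eq b hG hx]
  conv_rhs =>
    rw [← b.sum_repr v, ← b.sum_repr w]
    simp only [curvForm_sum_right, map_sum, map_smul, smul_eq_mul, Finset.sum_mul_sum]
  simp only [Finset.mul_sum]
  rw [Finset.sum_congr rfl fun i _ => Finset.sum_comm, Finset.sum_comm]
  refine Finset.sum_congr rfl fun a _ => ?_
  rw [Finset.sum_congr rfl fun i _ => Finset.sum_comm, Finset.sum_comm]
  refine Finset.sum_congr rfl fun c _ => Finset.sum_congr rfl fun i _ =>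
    Finset.sum_congr rfl fun j _ => by ring

omit hx in
/-- The scalar curvature in terms of the curvature form. -/
theorem scalarCoord_eq (b : Module.Basis ι ℝ E) {G : E → Matrix ι ι ℝ}
    (hG : ∀ y ∈ U, ∀ i j, G y i j = ∑ a, ε a * (θ a y (b i) * θ a y (b j)))
    {x : E} (hx : x ∈ U) :
    scalarCoord b G x = ∑ a, ∑ c, ε c * curvForm ψ a c x (X a x) (X c x) := by
  have h1 : ∀ i j, (G x)⁻¹ i j = ∑ e, ε e * (b.repr (X e x) i * b.repr (X e x) j) := by
    intro i j
    rw [h.inv_metric hx b (hG x hx), Matrix.mul_apply]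
    simp only [Matrix.mul_diagonal, Matrix.of_apply, Matrix.transpose_apply]
    exact Finset.sum_congr rfl fun e _ => by ring
  have h2 : scalarCoord b G x = ∑ e, ε e * ∑ i, ∑ j,
      b.repr (X e x) i * b.repr (X e x) j * ricciCoord b G i j x := by
    simp only [scalarCoord, h1, Finset.sum_mul, Finset.mul_sum]
    rw [Finset.sum_congr rfl fun i _ => Finset.sum_comm, Finset.sum_comm]
    refine Finset.sum_congr rfl fun e _ => Finset.sum_congr rfl fun i _ =>
      Finset.sum_congr rfl fun j _ => by ring
  rw [h2]
  simp only [h.sum_ricciCoord_eq b hG hx, h.dual x hx]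
  simp only [mul_ite, mul_one, mul_zero, Finset.sum_ite_eq', Finset.mem_univ, if_true,
    Finset.mul_sum]
  rw [Finset.sum_comm]

end IsLeviCivita

end Cartan

/-! ### The flow on an open set of ℝ × V and its spacetime connection form. -/

section FlowInCoordinates

open scoped Topology

theorem two_le_infty : (2 : ℕ∞ω) ≤ ∞ :=
  ENat.LEInfty.out

variable {V : Type*} [NormedAddCommGroup V] [NormedSpace ℝ V]

/-- The real Killing spinorial flow equations on an open set of `ℝ × V`, for the lapse `β` and
the coframe `e = (e_u, e_l, e_n)` with dual frame `X`: `T` are the components in this frame of the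
second fundamental form, `s` those of `dβ`, and `f` is a potential. -/
structure FlowInCoordinates (lam : ℝ) (β : ℝ × V → ℝ) (e : Fin 3 → ℝ × V → V →L[ℝ] ℝ)
    (X : Fin 3 → ℝ × V → V) (T : Fin 3 → Fin 3 → ℝ × V → ℝ) (s : Fin 3 → ℝ × V → ℝ)
    (f : ℝ × V → ℝ) (U : Set (ℝ × V)) : Prop where
  isOpen : IsOpen U
  smooth_β : ContDiffOn ℝ ∞ β U
  smooth_e : ∀ a, ContDiffOn ℝ ∞ (e a) U
  smooth_X : ∀ a, ContDiffOn ℝ ∞ (X a) U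
  smooth_T : ∀ a c, ContDiffOn ℝ ∞ (T a c) U
  smooth_s : ∀ a, ContDiffOn ℝ ∞ (s a) U
  smooth_f : ContDiffOn ℝ ∞ f U
  β_ne : ∀ y ∈ U, β y ≠ 0
  dual : ∀ y ∈ U, ∀ a c, e a y (X c y) = if a = c then 1 else 0
  T_symm : ∀ y ∈ U, ∀ a c, T a c y = T c a y
  dβ : ∀ y ∈ U, ∀ v, fderiv ℝ β y (0, v) = ∑ a, s a y * e a y v
  evol_eu : ∀ y ∈ U, ∀ v, fderiv ℝ (e 0) y (1, 0) v + s 0 y * e 0 y v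
    + β y * ∑ a, T 0 a y * e a y v = fderiv ℝ β y (0, v) + lam * β y * e 1 y v
  evol_el : ∀ y ∈ U, ∀ v, fderiv ℝ (e 1) y (1, 0) v + β y * ∑ a, T 1 a y * e a y v
    = -(s 1 y + lam * β y) * e 0 y v
  evol_en : ∀ y ∈ U, ∀ v, fderiv ℝ (e 2) y (1, 0) v + β y * ∑ a, T 2 a y * e a y v
    = -s 2 y * e 0 y v
  d_eu : ∀ y ∈ U, ∀ v w, fderiv ℝ (e 0) y (0, v) w - fderiv ℝ (e 0) y (0, w) v
    = (∑ a, T 0 a y * e a y v - lam * e 1 y v) * e 0 y w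
      - (∑ a, T 0 a y * e a y w - lam * e 1 y w) * e 0 y v
  d_el : ∀ y ∈ U, ∀ v w, fderiv ℝ (e 1) y (0, v) w - fderiv ℝ (e 1) y (0, w) v
    = (∑ a, T 1 a y * e a y v) * e 0 y w - (∑ a, T 1 a y * e a y w) * e 0 y v
  d_en : ∀ y ∈ U, ∀ v w, fderiv ℝ (e 2) y (0, v) w - fderiv ℝ (e 2) y (0, w) v
    + lam * (e 1 y v * e 2 y w - e 1 y w * e 2 y v)
    = (∑ a, T 2 a y * e a y v) * e 0 y w - (∑ a, T 2 a y * e a y w) * e 0 y v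
  df_space : ∀ y ∈ U, ∀ v, fderiv ℝ f y (0, v) = -∑ a, T 0 a y * e a y v - lam * e 1 y v
  df_time : ∀ y ∈ U, fderiv ℝ f y (1, 0) = s 0 y

section Definitions

variable (lam : ℝ) (β : ℝ × V → ℝ) (e : Fin 3 → ℝ × V → V →L[ℝ] ℝ) (X : Fin 3 → ℝ × V → V)
  (T : Fin 3 → Fin 3 → ℝ × V → ℝ) (s : Fin 3 → ℝ × V → ℝ)

/-- The coframe `(β dt, e_u, e_l, e_n)`. -/
def coframe4 : Unit ⊕ Fin 3 → ℝ × V → (ℝ × V) →L[ℝ] ℝ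
  | .inl _ => fun y => β y • ContinuousLinearMap.fst ℝ ℝ V
  | .inr a => fun y => (e a y).comp (ContinuousLinearMap.snd ℝ ℝ V)

/-- The frame dual to `coframe4`. -/
def frame4 : Unit ⊕ Fin 3 → ℝ × V → ℝ × V
  | .inl _ => fun y => ((β y)⁻¹, 0)
  | .inr a => fun y => (0, X a y)

/-- The one-form `Θ(e_a) - dβ(e_a) dt`. -/
def boostForm (a : Fin 3) (y : ℝ × V) : (ℝ × V) →L[ℝ] ℝ :=
  (∑ c, T a c y • (e c y).comp (ContinuousLinearMap.snd ℝ ℝ V))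
    - s a y • ContinuousLinearMap.fst ℝ ℝ V

/-- The null one-form `β dt + e_u`. -/
def nullForm (y : ℝ × V) : (ℝ × V) →L[ℝ] ℝ :=
  coframe4 β e (.inl ()) y + coframe4 β e (.inr 0) y

/-- The spatial block of the connection form. -/
def rotForm : Fin 3 → Fin 3 → ℝ × V → (ℝ × V) →L[ℝ] ℝ :=
  ![![fun _ => 0, fun y => boostForm e T s 1 y + (-lam) • nullForm β e y,
      fun y => boostForm e T s 2 y],
    ![fun y => -(boostForm e T s 1 y + (-lam) • nullForm β e y), fun _ => 0,
      fun y => lam • coframe4 β e (.inr 2) y],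
    ![fun y => -boostForm e T s 2 y,
      fun y => (-lam) • coframe4 β e (.inr 2) y, fun _ => 0]]

/-- The connection form. -/
def conn4 : Unit ⊕ Fin 3 → Unit ⊕ Fin 3 → ℝ × V → (ℝ × V) →L[ℝ] ℝ
  | .inl _, .inl _ => fun _ => 0
  | .inl _, .inr a => fun y => -boostForm e T s a y
  | .inr a, .inl _ => fun y => -boostForm e T s a y
  | .inr a, .inr c => rotForm lam β e T s a c

/-- The signs of the Lorentzian metric. -/
def sign4 : Unit ⊕ Fin 3 → ℝ
  | .inl _ => -1
  | .inr _ => 1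

end Definitions

namespace FlowInCoordinates

variable {lam : ℝ} {β : ℝ × V → ℝ} {e : Fin 3 → ℝ × V → V →L[ℝ] ℝ} {X : Fin 3 → ℝ × V → V}
  {T : Fin 3 → Fin 3 → ℝ × V → ℝ} {s : Fin 3 → ℝ × V → ℝ} {f : ℝ × V → ℝ} {U : Set (ℝ × V)}
  (h : FlowInCoordinates lam β e X T s f U)
include h

theorem contDiffOn_coframe4 (a : Unit ⊕ Fin 3) : ContDiffOn ℝ ∞ (coframe4 β e a) U := by
  rcases a with _ | a
  · exact h.smooth_β.smul contDiffOn_const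
  · exact (h.smooth_e a).clm_comp contDiffOn_const

theorem contDiffOn_frame4 (a : Unit ⊕ Fin 3) : ContDiffOn ℝ ∞ (frame4 β X a) U := by
  rcases a with _ | a
  · exact (h.smooth_β.inv h.β_ne).prodMk contDiffOn_const
  · exact contDiffOn_const.prodMk (h.smooth_X a)

theorem contDiffOn_boostForm (a : Fin 3) : ContDiffOn ℝ ∞ (boostForm e T s a) U := by
  refine ContDiffOn.sub (ContDiffOn.sum fun c _ => (h.smooth_T a c).smul
    ((h.smooth_e c).clm_comp contDiffOn_const)) ((h.smooth_s a).smul contDiffOn_const)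

theorem contDiffOn_nullForm : ContDiffOn ℝ ∞ (nullForm β e) U :=
  (h.contDiffOn_coframe4 (.inl ())).add (h.contDiffOn_coframe4 (.inr 0))

theorem contDiffOn_conn4 (a c : Unit ⊕ Fin 3) : ContDiffOn ℝ ∞ (conn4 lam β e T s a c) U := by
  have h2 := h.contDiffOn_coframe4 (.inr 2)
  have hn : ContDiffOn ℝ ∞ (fun y => boostForm e T s 1 y + (-lam) • nullForm β e y) U :=
    (h.contDiffOn_boostForm 1).add (h.contDiffOn_nullForm.const_smul _)
  rcases a with _ | a <;> rcases c with _ | c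
  · exact contDiffOn_const
  · exact (h.contDiffOn_boostForm c).neg
  · exact (h.contDiffOn_boostForm a).neg
  · fin_cases a <;> fin_cases c
    · exact contDiffOn_const
    · exact hn
    · exact h.contDiffOn_boostForm 2
    · exact hn.neg
    · exact contDiffOn_const
    · exact h2.const_smul _
    · exact (h.contDiffOn_boostForm 2).neg
    · exact h2.const_smul _
    · exact contDiffOn_const

omit h in
theorem fderiv_pair {F : Type*} [NormedAddCommGroup F] [NormedSpace ℝ F] (g : ℝ × V → F)
    (y p : ℝ × V) : fderiv ℝ g y p = p.1 • fderiv ℝ g y (1, 0) + fderiv ℝ g y (0, p.2) := by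
  rw [← map_smul, ← map_add]
  simp

theorem dForm_time {y : ℝ × V} (hy : y ∈ U) (p q : ℝ × V) :
    dForm (coframe4 β e (.inl ())) y p q = fderiv ℝ β y p * q.1 - fderiv ℝ β y q * p.1 := by
  have hd : DifferentiableAt ℝ β y :=
    (h.smooth_β.contDiffAt (h.isOpen.mem_nhds hy)).differentiableAt (by simp)
  have : fderiv ℝ (coframe4 β e (.inl ())) y
      = (fderiv ℝ β y).smulRight (ContinuousLinearMap.fst ℝ ℝ V) :=
    (hd.hasFDerivAt.smul_const (ContinuousLinearMap.fst ℝ ℝ V)).fderiv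
  simp [dForm, this]

theorem dForm_space {y : ℝ × V} (hy : y ∈ U) (a : Fin 3) (p q : ℝ × V) :
    dForm (coframe4 β e (.inr a)) y p q
      = fderiv ℝ (e a) y p q.2 - fderiv ℝ (e a) y q p.2 := by
  have hd : DifferentiableAt ℝ (e a) y :=
    ((h.smooth_e a).contDiffAt (h.isOpen.mem_nhds hy)).differentiableAt (by simp)
  have h1 : ∀ p q : ℝ × V, fderiv ℝ (coframe4 β e (.inr a)) y p q = fderiv ℝ (e a) y p q.2 := by
    intro p q
    have := (hd.hasFDerivAt.clm_comp
      (hasFDerivAt_const (ContinuousLinearMap.snd ℝ ℝ V) y)).fderiv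
    change fderiv ℝ (fun y => (e a y).comp (ContinuousLinearMap.snd ℝ ℝ V)) y p q = _
    rw [this]
    simp
  rw [dForm, h1, h1]

/-- The torsion equation of β dt is the expansion of dβ together with the symmetry of Θ. That of
each e_a splits into its dt ∧ part, which is the evolution equation, and its spatial part, which is
the equation for de_a. -/
theorem isLeviCivita4 :
    IsLeviCivita sign4 (coframe4 β e) (frame4 β X) (conn4 lam β e T s) U where
  isOpen := h.isOpen
  sign a := by rcases a with _ | a <;> simp [sign4]
  smooth_θ a := (h.contDiffOn_coframe4 a).of_le two_le_infty
  smooth_X a := (h.contDiffOn_frame4 a).of_le (by exact_mod_cast le_top)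
  smooth_ψ a c := (h.contDiffOn_conn4 a c).of_le (by exact_mod_cast le_top)
  dual y hy a c := by
    have := h.β_ne y hy
    rcases a with _ | a <;> rcases c with _ | c <;> simp [coframe4, frame4, this, h.dual y hy]
  torsion y hy a p q := by
    have hs := h.T_symm y hy
    have hp := h.dβ y hy p.2
    have hq := h.dβ y hy q.2
    rcases a with _ | a
    · rw [h.dForm_time hy, fderiv_pair β y p, fderiv_pair β y q, hp, hq]
      simp only [Fintype.sum_sum_type, Finset.univ_unique, Finset.sum_singleton, Fin.sum_univ_three,
        conn4, coframe4, boostForm]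
      simp
      rw [hs 1 0, hs 2 0, hs 2 1]
      ring
    · rw [h.dForm_space hy, fderiv_pair (e a) y p, fderiv_pair (e a) y q]
      fin_cases a
      · have e1 := h.evol_eu y hy p.2
        have e2 := h.evol_eu y hy q.2
        have e3 := h.d_eu y hy p.2 q.2
        rw [hp] at e1
        rw [hq] at e2
        simp only [Fintype.sum_sum_type, Finset.univ_unique, Finset.sum_singleton,
          Fin.sum_univ_three, conn4, coframe4, boostForm, rotForm, nullForm] at *
        simp at *
        rw [hs 1 0, hs 2 0, hs 2 1] at *
        -- `p.1` and `q.1` are the dt-components: dt ∧ (evolution equation) plus the spatial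
        -- equation.
        linear_combination p.1 * e2 - q.1 * e1 + e3
      · have e1 := h.evol_el y hy p.2
        have e2 := h.evol_el y hy q.2
        have e3 := h.d_el y hy p.2 q.2
        simp only [Fintype.sum_sum_type, Finset.univ_unique, Finset.sum_singleton,
          Fin.sum_univ_three, conn4, coframe4, boostForm, rotForm, nullForm] at *
        simp at *
        linear_combination p.1 * e2 - q.1 * e1 + e3
      · have e1 := h.evol_en y hy p.2
        have e2 := h.evol_en y hy q.2
        have e3 := h.d_en y hy p.2 q.2
        simp only [Fintype.sum_sum_type, Finset.univ_unique, Finset.sum_singleton,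
          Fin.sum_univ_three, conn4, coframe4, boostForm, rotForm, nullForm] at *
        simp at *
        linear_combination p.1 * e2 - q.1 * e1 + e3
  skew y hy a c p := by
    rcases a with _ | a <;> rcases c with _ | c
    · simp [conn4]
    · simp [conn4, sign4]
    · simp [conn4, sign4]
    · fin_cases a <;> fin_cases c <;> simp [conn4, sign4, rotForm]

variable {y : ℝ × V} (hy : y ∈ U)
include hy

theorem differentiableAt_boostForm (a : Fin 3) : DifferentiableAt ℝ (boostForm e T s a) y :=
  ((h.contDiffOn_boostForm a).contDiffAt (h.isOpen.mem_nhds hy)).differentiableAt (by simp)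

theorem differentiableAt_coframe4 (a : Unit ⊕ Fin 3) : DifferentiableAt ℝ (coframe4 β e a) y :=
  ((h.contDiffOn_coframe4 a).contDiffAt (h.isOpen.mem_nhds hy)).differentiableAt (by simp)

theorem differentiableAt_nullForm : DifferentiableAt ℝ (nullForm β e) y :=
  (h.contDiffOn_nullForm.contDiffAt (h.isOpen.mem_nhds hy)).differentiableAt (by simp)

/-- The existence of a potential makes `Θ(e_u) - dβ(e_u) dt + λ e_l` closed. -/
theorem dForm_boostForm_zero (p q : ℝ × V) :
    dForm (boostForm e T s 0) y p q = -lam * dForm (coframe4 β e (.inr 1)) y p q := by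
  have hf := (h.smooth_f.contDiffAt (h.isOpen.mem_nhds hy))
  -- Both conditions on the potential together read B_u = -df - λ e_l on spacetime.
  have ev : boostForm e T s 0 =ᶠ[𝓝 y]
      fun z => -fderiv ℝ f z + (-lam) • coframe4 β e (.inr 1) z := by
    filter_upwards [h.isOpen.mem_nhds hy] with z hz
    ext p
    · simp [boostForm, coframe4, h.df_time z hz]
    · simp [boostForm, coframe4, h.df_space z hz]
  have hd : DifferentiableAt ℝ (fderiv ℝ f) y :=
    (hf.fderiv_right (m := 1) (by rw [one_add_one_eq_two]; exact two_le_infty)).differentiableAt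
      (by simp)
  rw [dForm_congr ev, dForm_add hd.fun_neg ((h.differentiableAt_coframe4 hy _).fun_const_smul (-lam)),
    dForm_neg, dForm_fderiv (hf.of_le two_le_infty),
    dForm_const_smul (h.differentiableAt_coframe4 hy _)]
  ring

theorem dForm_nullForm (p q : ℝ × V) :
    dForm (nullForm β e) y p q = dForm (coframe4 β e (.inl ())) y p q
      + dForm (coframe4 β e (.inr 0)) y p q :=
  dForm_add (h.differentiableAt_coframe4 hy _) (h.differentiableAt_coframe4 hy _) p q

/-- Here dψ⁰_u = λ de_l, and the torsion equation expands this as λ B_l ∧ ν - λ² θ⁰ ∧ e_u. The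
quadratic term ψ⁰_l ∧ ψ^l_u cancels λ B_l ∧ ν. This is where the potential enters the curvature
computation. -/
theorem curvForm_time_u (p q : ℝ × V) :
    curvForm (conn4 lam β e T s) (.inl ()) (.inr 0) y p q
      = -lam ^ 2 * (coframe4 β e (.inl ()) y p * coframe4 β e (.inr 0) y q
        - coframe4 β e (.inl ()) y q * coframe4 β e (.inr 0) y p) := by
  have t := h.isLeviCivita4.torsion y hy (.inr 1) p q
  simp only [curvForm, conn4, dForm_neg, h.dForm_boostForm_zero hy, Fintype.sum_sum_type,
    Finset.univ_unique, Finset.sum_singleton, Fin.sum_univ_three] at *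
  rw [t]
  simp [rotForm, nullForm, coframe4]
  ring

/-- Since ψ^n_l = -λ e_n, the torsion equation gives its differential. The resulting term -λ B_n ∧ ν
cancels against the quadratic terms through 0 and u. -/
theorem curvForm_n_l (p q : ℝ × V) :
    curvForm (conn4 lam β e T s) (.inr 2) (.inr 1) y p q
      = -lam ^ 2 * (coframe4 β e (.inr 2) y p * coframe4 β e (.inr 1) y q
        - coframe4 β e (.inr 2) y q * coframe4 β e (.inr 1) y p) := by
  have t := h.isLeviCivita4.torsion y hy (.inr 2) p q
  have d : dForm (conn4 lam β e T s (.inr 2) (.inr 1)) y p q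
      = -lam * dForm (coframe4 β e (.inr 2)) y p q := by
    have : conn4 lam β e T s (.inr 2) (.inr 1) = fun y => (-lam) • coframe4 β e (.inr 2) y := rfl
    rw [this, dForm_const_smul (h.differentiableAt_coframe4 hy _)]
  rw [curvForm, d, t]
  simp only [conn4, Fintype.sum_sum_type,
    Finset.univ_unique, Finset.sum_singleton, Fin.sum_univ_three]
  simp [rotForm, nullForm, coframe4]
  ring

/-- The reason is ψ^l_u = ψ^l_0 + λν: the two curvatures differ by λ dν and by quadratic terms,
which the torsion equations evaluate. -/
theorem curvForm_l_u (p q : ℝ × V) :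
    curvForm (conn4 lam β e T s) (.inr 1) (.inr 0) y p q
      = curvForm (conn4 lam β e T s) (.inr 1) (.inl ()) y p q
        - lam ^ 2 * (coframe4 β e (.inr 1) y p * nullForm β e y q
          - coframe4 β e (.inr 1) y q * nullForm β e y p) := by
  have t0 := h.isLeviCivita4.torsion y hy (.inl ()) p q
  have t1 := h.isLeviCivita4.torsion y hy (.inr 0) p q
  have d : dForm (conn4 lam β e T s (.inr 1) (.inr 0)) y p q
      = -dForm (boostForm e T s 1) y p q + lam * dForm (nullForm β e) y p q := by
    have h1 := dForm_neg (fun y => boostForm e T s 1 y + (-lam) • nullForm β e y) y p q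
    rw [dForm_add (h.differentiableAt_boostForm hy 1)
      ((h.differentiableAt_nullForm hy).fun_const_smul (-lam)),
      dForm_const_smul (h.differentiableAt_nullForm hy)] at h1
    exact h1.trans (by ring)
  rw [curvForm, d, h.dForm_nullForm hy, t0, t1, curvForm]
  simp only [conn4, Fintype.sum_sum_type, dForm_neg,
    Finset.univ_unique, Finset.sum_singleton, Fin.sum_univ_three]
  simp [rotForm, nullForm, coframe4]
  ring

-- As ψ^n_u = ψ^n_0, the only discrepancy is ψ^n_l ∧ (ψ^l_u - ψ^l_0) = -λ² e_n ∧ ν. The identity is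
-- algebraic in the connection form and uses no flow equation.
omit h hy in
theorem curvForm_n_u (p q : ℝ × V) :
    curvForm (conn4 lam β e T s) (.inr 2) (.inr 0) y p q
      = curvForm (conn4 lam β e T s) (.inr 2) (.inl ()) y p q
        - lam ^ 2 * (coframe4 β e (.inr 2) y p * nullForm β e y q
          - coframe4 β e (.inr 2) y q * nullForm β e y p) := by
  have d : dForm (conn4 lam β e T s (.inr 2) (.inr 0)) y p q
      = -dForm (boostForm e T s 2) y p q := dForm_neg _ _ _ _
  rw [curvForm, d, curvForm]
  simp only [conn4, Fintype.sum_sum_type, dForm_neg,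
    Finset.univ_unique, Finset.sum_singleton, Fin.sum_univ_three]
  simp [rotForm, nullForm, coframe4]
  ring

end FlowInCoordinates

end FlowInCoordinates

/-! ### Ricci tensor of the flow: Bianchi identity and Gauss equation. -/

section FlowCurvature

open scoped Topology

variable {V : Type*} [NormedAddCommGroup V] [NormedSpace ℝ V]

namespace FlowInCoordinates

variable {lam : ℝ} {β : ℝ × V → ℝ} {e : Fin 3 → ℝ × V → V →L[ℝ] ℝ} {X : Fin 3 → ℝ × V → V}
  {T : Fin 3 → Fin 3 → ℝ × V → ℝ} {s : Fin 3 → ℝ × V → ℝ} {f : ℝ × V → ℝ} {U : Set (ℝ × V)}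
  (h : FlowInCoordinates lam β e X T s f U) {y : ℝ × V} (hy : y ∈ U)

variable (lam β e T s) in
/-- The part `Ω^a_0 - λ² e^a ∧ θ^0` of the curvature form that is not of constant curvature, for
the spatial index `a`. -/
def excessForm (a : Fin 3) (y p q : ℝ × V) : ℝ :=
  curvForm (conn4 lam β e T s) (.inr a) (.inl ()) y p q
    - lam ^ 2 * (coframe4 β e (.inr a) y p * coframe4 β e (.inl ()) y q
      - coframe4 β e (.inr a) y q * coframe4 β e (.inl ()) y p)

variable (lam β e X T s) in
/-- The coefficient of the square of the null one-form in the Ricci tensor. -/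
def nullCoeff (y : ℝ × V) : ℝ :=
  -excessForm lam β e T s 1 y (frame4 β X (.inr 0) y) (frame4 β X (.inr 1) y)
    - excessForm lam β e T s 2 y (frame4 β X (.inr 0) y) (frame4 β X (.inr 2) y)

theorem excessForm_swap (a : Fin 3) (p q : ℝ × V) :
    excessForm lam β e T s a y p q = -excessForm lam β e T s a y q p := by
  rw [excessForm, excessForm, curvForm_swap]
  ring

include h hy

theorem curvForm_self (a : Unit ⊕ Fin 3) (p q : ℝ × V) :
    curvForm (conn4 lam β e T s) a a y p q = 0 := by
  have := h.isLeviCivita4.curvForm_skew hy a a p q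
  rcases a with _ | a <;> simp only [sign4] at this <;> linarith

theorem curvForm_space (a c : Fin 3) (p q : ℝ × V) :
    curvForm (conn4 lam β e T s) (.inr a) (.inr c) y p q
      = -curvForm (conn4 lam β e T s) (.inr c) (.inr a) y p q := by
  have := h.isLeviCivita4.curvForm_skew hy (.inr a) (.inr c) p q
  simp only [sign4] at this
  linarith

theorem curvForm_time (a : Fin 3) (p q : ℝ × V) :
    curvForm (conn4 lam β e T s) (.inl ()) (.inr a) y p q
      = curvForm (conn4 lam β e T s) (.inr a) (.inl ()) y p q := by
  have := h.isLeviCivita4.curvForm_skew hy (.inl ()) (.inr a) p q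
  simp only [sign4] at this
  linarith

omit h hy in
theorem curvForm_l_time (p q : ℝ × V) :
    curvForm (conn4 lam β e T s) (.inr 1) (.inl ()) y p q = excessForm lam β e T s 1 y p q
      + lam ^ 2 * (coframe4 β e (.inr 1) y p * coframe4 β e (.inl ()) y q
        - coframe4 β e (.inr 1) y q * coframe4 β e (.inl ()) y p) := by
  rw [excessForm]; ring

omit h hy in
theorem curvForm_n_time (p q : ℝ × V) :
    curvForm (conn4 lam β e T s) (.inr 2) (.inl ()) y p q = excessForm lam β e T s 2 y p q
      + lam ^ 2 * (coframe4 β e (.inr 2) y p * coframe4 β e (.inl ()) y q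
        - coframe4 β e (.inr 2) y q * coframe4 β e (.inl ()) y p) := by
  rw [excessForm]; ring

/-- Bianchi identity for the index a = l or n: the constant curvature terms cancel among themselves.
Since the columns 0 and u carry the same excess Ξ^a, what remains is Ξ^a ∧ (θ⁰ + e_u) = 0. -/
theorem excessForm_bianchi (a : Fin 3) (ha : a = 1 ∨ a = 2) (p q r : ℝ × V) :
    excessForm lam β e T s a y p q * nullForm β e y r
      + excessForm lam β e T s a y q r * nullForm β e y p
      + excessForm lam β e T s a y r p * nullForm β e y q = 0 := by
  have B := h.isLeviCivita4.bianchi hy (.inr a) p q r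
  rcases ha with rfl | rfl <;>
  · simp only [Fintype.sum_sum_type, Finset.univ_unique, Finset.sum_singleton, Fin.sum_univ_three,
      PUnit.default_eq_unit, h.curvForm_self hy, h.curvForm_space hy 1 2, h.curvForm_n_l hy,
      h.curvForm_l_u hy, curvForm_n_u, curvForm_l_time, curvForm_n_time, nullForm,
      add_apply] at B ⊢
    linear_combination B

/-- Bianchi identity for the index 0: the column u has no excess, which leaves Ξ^l ∧ e_l + Ξ^n ∧ e_n
= 0. -/
theorem excessForm_bianchi_time (p q r : ℝ × V) :
    excessForm lam β e T s 1 y p q * coframe4 β e (.inr 1) y r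
      + excessForm lam β e T s 1 y q r * coframe4 β e (.inr 1) y p
      + excessForm lam β e T s 1 y r p * coframe4 β e (.inr 1) y q
      + excessForm lam β e T s 2 y p q * coframe4 β e (.inr 2) y r
      + excessForm lam β e T s 2 y q r * coframe4 β e (.inr 2) y p
      + excessForm lam β e T s 2 y r p * coframe4 β e (.inr 2) y q = 0 := by
  have B := h.isLeviCivita4.bianchi hy (.inl ()) p q r
  simp only [Fintype.sum_sum_type, Finset.univ_unique, Finset.sum_singleton, Fin.sum_univ_three,
    PUnit.default_eq_unit, h.curvForm_self hy, h.curvForm_time_u hy, h.curvForm_time hy 1,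
    h.curvForm_time hy 2, curvForm_l_time, curvForm_n_time] at B
  linear_combination B

theorem coframe4_frame4 (a c : Unit ⊕ Fin 3) :
    coframe4 β e a y (frame4 β X c y) = if a = c then 1 else 0 :=
  h.isLeviCivita4.dual y hy a c

/-- Evaluate the previous identity on X_u, X_0, X_a: e_l and e_n vanish on the first two vectors, so
one term is left. -/
theorem excessForm_u_time (a : Fin 3) (ha : a = 1 ∨ a = 2) :
    excessForm lam β e T s a y (frame4 β X (.inr 0) y) (frame4 β X (.inl ()) y) = 0 := by
  have B := h.excessForm_bianchi_time hy (frame4 β X (.inr 0) y) (frame4 β X (.inl ()) y)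
    (frame4 β X (.inr a) y)
  rcases ha with rfl | rfl <;> simpa [h.coframe4_frame4 hy] using B

/-- From Ξ^a ∧ ν = 0 on X_0, X_u and p, because ν equals 1 on both X_0 and X_u. -/
theorem excessForm_time_eq (a : Fin 3) (ha : a = 1 ∨ a = 2) (p : ℝ × V) :
    excessForm lam β e T s a y (frame4 β X (.inl ()) y) p
      = excessForm lam β e T s a y (frame4 β X (.inr 0) y) p := by
  have B := h.excessForm_bianchi hy a ha (frame4 β X (.inl ()) y) (frame4 β X (.inr 0) y) p
  rw [excessForm_swap a (frame4 β X (.inl ()) y) (frame4 β X (.inr 0) y),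
    h.excessForm_u_time hy a ha, excessForm_swap a p] at B
  simp [nullForm, h.coframe4_frame4 hy] at B
  linarith

/-- From Ξ^a ∧ ν = 0 on X_u, X_c and p, because ν vanishes on X_c. Its cases c = a supply the factor
ν(p) in the Ricci tensor. -/
theorem excessForm_spatial_eq (a c : Fin 3) (ha : a = 1 ∨ a = 2) (hc : c = 1 ∨ c = 2)
    (p : ℝ × V) :
    excessForm lam β e T s a y (frame4 β X (.inr c) y) p
      = -excessForm lam β e T s a y (frame4 β X (.inr 0) y) (frame4 β X (.inr c) y)
        * nullForm β e y p := by
  have B := h.excessForm_bianchi hy a ha (frame4 β X (.inr 0) y) (frame4 β X (.inr c) y) p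
  rcases hc with rfl | rfl <;> simp [nullForm, h.coframe4_frame4 hy] at B ⊢ <;> linarith

/-- The Ricci tensor of a real Killing spinorial flow, in terms of `nullCoeff`. -/
theorem ricci_eq (p q : ℝ × V) :
    ∑ a, ∑ c, curvForm (conn4 lam β e T s) a c y (frame4 β X a y) p * coframe4 β e c y q
      = -3 * lam ^ 2 * ∑ a, sign4 a * (coframe4 β e a y p * coframe4 β e a y q)
        + nullCoeff lam β e X T s y * (nullForm β e y p * nullForm β e y q) := by
  have t1 := h.excessForm_time_eq hy 1 (.inl rfl) p
  have t2 := h.excessForm_time_eq hy 2 (.inr rfl) p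
  have s1 := h.excessForm_spatial_eq hy 1 1 (.inl rfl) (.inl rfl) p
  have s2 := h.excessForm_spatial_eq hy 2 2 (.inr rfl) (.inr rfl) p
  have d := h.coframe4_frame4 hy
  simp only [Fintype.sum_sum_type, Finset.univ_unique, Finset.sum_singleton, Fin.sum_univ_three,
    PUnit.default_eq_unit, h.curvForm_self hy, h.curvForm_space hy 1 2, h.curvForm_space hy 0 1,
    h.curvForm_space hy 0 2, h.curvForm_n_l hy, ← h.curvForm_time hy 0,
    h.curvForm_l_u hy, curvForm_n_u, h.curvForm_time_u hy, h.curvForm_time hy 1,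
    h.curvForm_time hy 2, curvForm_l_time, curvForm_n_time, t1, t2, s1, s2, nullForm,
    add_apply, d, sign4, nullCoeff]
  simp
  ring

omit h hy in
theorem dForm_slice {α : ℝ × V → (ℝ × V) →L[ℝ] ℝ} {t : ℝ} {x : V}
    (hα : DifferentiableAt ℝ α (t, x)) (v w : V) :
    dForm (fun z => (α (t, z)).comp (ContinuousLinearMap.inr ℝ ℝ V)) x v w
      = dForm α (t, x) (0, v) (0, w) := by
  have h1 : HasFDerivAt (fun z : V => α (t, z))
      ((fderiv ℝ α (t, x)).comp (ContinuousLinearMap.inr ℝ ℝ V)) x :=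
    hα.hasFDerivAt.comp x (hasFDerivAt_prodMk_right t x)
  have h2 : ∀ v w : V, fderiv ℝ (fun z => (α (t, z)).comp (ContinuousLinearMap.inr ℝ ℝ V)) x v w
      = fderiv ℝ α (t, x) (0, v) (0, w) := by
    intro v w
    rw [(h1.clm_comp (hasFDerivAt_const (ContinuousLinearMap.inr ℝ ℝ V) x)).fderiv]
    simp
  rw [dForm, dForm, h2, h2]

-- On a slice β dt pulls back to zero, so the spatial block of the spacetime connection form
-- restricts to a torsion-free, skew connection form for h_t.
omit hy in
theorem isLeviCivita_slice (t : ℝ) :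
    IsLeviCivita (fun _ => 1) (fun a x => e a (t, x)) (fun a x => X a (t, x))
      (fun a c x => (rotForm lam β e T s a c (t, x)).comp (ContinuousLinearMap.inr ℝ ℝ V))
      {x | (t, x) ∈ U} := by
  have hi : ContDiff ℝ ∞ fun x : V => (t, x) := contDiff_prodMk_right t
  have hm : MapsTo (fun x : V => (t, x)) {x | (t, x) ∈ U} U := fun x hx => hx
  refine ⟨h.isOpen.preimage hi.continuous, fun _ => one_mul 1,
    fun a => ((h.smooth_e a).comp hi.contDiffOn hm).of_le two_le_infty,
    fun a => ((h.smooth_X a).comp hi.contDiffOn hm).of_le (by exact_mod_cast le_top),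
    fun a c => (((h.contDiffOn_conn4 (.inr a) (.inr c)).comp hi.contDiffOn hm).clm_comp
      contDiffOn_const).of_le (by exact_mod_cast le_top), fun x hx => h.dual _ hx, ?_, ?_⟩
  · intro x hx a v w
    have h1 : (fun x => e a (t, x)) = fun z : V =>
        (coframe4 β e (.inr a) (t, z)).comp (ContinuousLinearMap.inr ℝ ℝ V) := by
      ext z v; simp [coframe4]
    rw [h1, dForm_slice (h.differentiableAt_coframe4 hx (.inr a)),
      h.isLeviCivita4.torsion _ hx, Fintype.sum_sum_type]
    simp [conn4, coframe4]
  · intro x hx a c v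
    simpa [conn4, sign4] using h.isLeviCivita4.skew _ hx (.inr a) (.inr c) (0, v)

omit hy in
/-- The Gauss equation for the slice of constant time. -/
theorem curvForm_slice {t : ℝ} {x : V} (hx : (t, x) ∈ U) (a c d g : Fin 3) :
    curvForm (fun a c x => (rotForm lam β e T s a c (t, x)).comp (ContinuousLinearMap.inr ℝ ℝ V))
        a c x (X d (t, x)) (X g (t, x))
      = curvForm (conn4 lam β e T s) (.inr a) (.inr c) (t, x)
          (frame4 β X (.inr d) (t, x)) (frame4 β X (.inr g) (t, x))
        - (T a d (t, x) * T c g (t, x) - T a g (t, x) * T c d (t, x)) := by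
  have h1 := dForm_slice (h.isLeviCivita4.differentiableAt_ψ hx (.inr a) (.inr c))
    (X d (t, x)) (X g (t, x))
  have h2 : ∀ a d, boostForm e T s a (t, x) (0, X d (t, x)) = T a d (t, x) := by
    intro a d
    simp [boostForm, h.dual _ hx]
  simp only [conn4] at h1
  rw [curvForm, curvForm, h1, Fintype.sum_sum_type]
  simp only [conn4, Finset.univ_unique, Finset.sum_singleton, frame4, neg_apply, h2]
  simp
  ring

/-- The Hamiltonian function of the flow is twice the coefficient of the square of the null
one-form in the Ricci tensor. -/
theorem two_mul_nullCoeff (b : Module.Basis (Fin 3) ℝ V) {G : V → Matrix (Fin 3) (Fin 3) ℝ}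
    (hG : ∀ x, (y.1, x) ∈ U →
      ∀ i j, G x i j = ∑ a, e a (y.1, x) (b i) * e a (y.1, x) (b j)) :
    2 * nullCoeff lam β e X T s y = scalarCoord b G y.2 - ∑ a, ∑ c, T a c y * T c a y
      + (∑ a, T a a y) ^ 2 + 6 * lam ^ 2 := by
  obtain ⟨t, x⟩ := y
  have hs := h.T_symm _ hy
  have d := h.coframe4_frame4 hy
  have sw := excessForm_swap (lam := lam) (β := β) (e := e) (T := T) (s := s) (y := (t, x))
  -- In the double contraction of the Gauss equation the six ordered pairs of spatial indices give
  -- -6λ² and the excess gives 2N. The Θ terms give |Θ|² - (Tr Θ)².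
  rw [(h.isLeviCivita_slice t).scalarCoord_eq b (fun x hx i j => by simpa using hG x hx i j) hy]
  simp only [h.curvForm_slice hy, Fin.sum_univ_three, h.curvForm_self hy, h.curvForm_space hy 1 2,
    h.curvForm_space hy 0 1, h.curvForm_space hy 0 2, h.curvForm_n_l hy, h.curvForm_l_u hy,
    curvForm_n_u, curvForm_l_time, curvForm_n_time, nullForm, add_apply, d, nullCoeff,
    hs 1 0, hs 2 0, hs 2 1]
  rw [sw 1 (frame4 β X (.inr 1) (t, x)) (frame4 β X (.inr 0) (t, x)),
    sw 2 (frame4 β X (.inr 2) (t, x)) (frame4 β X (.inr 0) (t, x))]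
  simp
  ring

end FlowInCoordinates

end FlowCurvature

/-! ### The preferred charts of `S` and smoothness of one-forms in them. -/

section Charts

open scoped Topology

local notation "𝔼" => EuclideanSpace ℝ (Fin 3)

/-- The extra term of the chain rule contains the second derivative of τ, which is symmetric and
drops out on antisymmetrisation. -/
theorem dForm_pullback {E : Type*} [NormedAddCommGroup E] [NormedSpace ℝ E]
    {α : E → E →L[ℝ] ℝ} {τ : E → E} {x : E} (hτ : ContDiffAt ℝ 2 τ x)
    (hα : DifferentiableAt ℝ α (τ x)) (v w : E) :
    dForm (fun z => (α (τ z)).comp (fderiv ℝ τ z)) x v w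
      = dForm α (τ x) (fderiv ℝ τ x v) (fderiv ℝ τ x w) := by
  have h1 : HasFDerivAt (fun z => α (τ z)) ((fderiv ℝ α (τ x)).comp (fderiv ℝ τ x)) x :=
    hα.hasFDerivAt.comp x (hτ.differentiableAt (by norm_num)).hasFDerivAt
  have h2 : HasFDerivAt (fderiv ℝ τ) (fderiv ℝ (fderiv ℝ τ) x) x :=
    ((hτ.fderiv_right (m := 1) (by norm_num)).differentiableAt (by norm_num)).hasFDerivAt
  have h3 : ∀ v w, fderiv ℝ (fun z => (α (τ z)).comp (fderiv ℝ τ z)) x v w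
      = fderiv ℝ α (τ x) (fderiv ℝ τ x v) (fderiv ℝ τ x w)
        + α (τ x) (fderiv ℝ (fderiv ℝ τ) x v w) := by
    intro v w
    rw [(h1.clm_comp h2).fderiv]
    simp [add_comm]
  rw [dForm, dForm, h3, h3, (hτ.isSymmSndFDerivAt (by simp)) v w]
  ring

variable {S : Type*} [TopologicalSpace S] [ChartedSpace (EuclideanSpace ℝ (Fin 3)) S]

/-- The differential of the inverse chart, as an endomorphism of the model space. -/
def chartFrame (p : S) (x : 𝔼) : 𝔼 →L[ℝ] 𝔼 := chartSymmDeriv (𝓡 3) p x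

/-- The differential of the chart at the point of coordinates `x`. -/
def chartCoframe (p : S) (x : 𝔼) : 𝔼 →L[ℝ] 𝔼 :=
  mfderiv (𝓡 3) 𝓘(ℝ, 𝔼) (extChartAt (𝓡 3) p) ((extChartAt (𝓡 3) p).symm x)

/-- A one-form in the preferred chart at `p`. -/
def pullForm (p : S) (α : S → 𝔼 →L[ℝ] ℝ) (x : 𝔼) : 𝔼 →L[ℝ] ℝ :=
  (α ((extChartAt (𝓡 3) p).symm x)).comp (chartFrame p x)

variable (p : S)

theorem isOpen_chartTarget : IsOpen (extChartAt (𝓡 3) p).target :=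
  isOpen_extChartAt_target p

variable [IsManifold (𝓡 3) ∞ S]

theorem isManifold_one : IsManifold (𝓡 3) 1 S :=
  IsManifold.of_le (n := ∞) (by exact_mod_cast le_top)

variable {p} {x : EuclideanSpace ℝ (Fin 3)} (hx : x ∈ (extChartAt (𝓡 3) p).target)
include hx

theorem mdifferentiableAt_chartSymm :
    MDifferentiableAt 𝓘(ℝ, 𝔼) (𝓡 3) (extChartAt (𝓡 3) p).symm x := by
  have := isManifold_one (S := S)
  exact (mdifferentiableOn_extChartAt_symm x hx).mdifferentiableAt
    ((isOpen_chartTarget p).mem_nhds hx)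

theorem chartFrame_comp_chartCoframe :
    (chartFrame p x).comp (chartCoframe p x) = ContinuousLinearMap.id ℝ 𝔼 := by
  have := isManifold_one (S := S)
  have h := mfderivWithin_extChartAt_symm_comp_mfderiv_extChartAt (I := 𝓡 3) hx
  rw [ModelWithCorners.Boundaryless.range_eq_univ, mfderivWithin_univ] at h
  exact h

theorem chartCoframe_comp_chartFrame :
    (chartCoframe p x).comp (chartFrame p x) = ContinuousLinearMap.id ℝ 𝔼 := by
  have := isManifold_one (S := S)
  have h := mfderiv_extChartAt_comp_mfderivWithin_extChartAt_symm (I := 𝓡 3) hx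
  rw [ModelWithCorners.Boundaryless.range_eq_univ, mfderivWithin_univ] at h
  exact h

theorem chartFrame_chartCoframe (v : 𝔼) : chartFrame p x (chartCoframe p x v) = v :=
  congrArg (fun L : 𝔼 →L[ℝ] 𝔼 => L v) (chartFrame_comp_chartCoframe hx)

theorem chartCoframe_chartFrame (v : 𝔼) : chartCoframe p x (chartFrame p x v) = v :=
  congrArg (fun L : 𝔼 →L[ℝ] 𝔼 => L v) (chartCoframe_comp_chartFrame hx)

omit hx
variable (p)

theorem contMDiffOn_chartSymm :
    ContMDiffOn 𝓘(ℝ, 𝔼) (𝓡 3) ∞ (extChartAt (𝓡 3) p).symm (extChartAt (𝓡 3) p).target :=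
  contMDiffOn_extChartAt_symm p

theorem contMDiffOn_prod_chartSymm (J : Set ℝ) :
    ContMDiffOn 𝓘(ℝ, ℝ × 𝔼) (𝓘(ℝ, ℝ).prod (𝓡 3)) ∞
      (fun y : ℝ × 𝔼 => (y.1, (extChartAt (𝓡 3) p).symm y.2))
      (J ×ˢ (extChartAt (𝓡 3) p).target) := by
  refine ContMDiffOn.prodMk contDiff_fst.contMDiff.contMDiffOn ?_
  exact (contMDiffOn_chartSymm p).comp contDiff_snd.contMDiff.contMDiffOn fun y hy => hy.2

theorem SmoothFunctions.contDiffOn_chart {J : Set ℝ} {f : ℝ → S → ℝ} (hf : SmoothFunctions J f) :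
    ContDiffOn ℝ ∞ (fun y : ℝ × 𝔼 => f y.1 ((extChartAt (𝓡 3) p).symm y.2))
      (J ×ˢ (extChartAt (𝓡 3) p).target) := by
  rw [← contMDiffOn_iff_contDiffOn]
  exact ContMDiffOn.comp hf (contMDiffOn_prod_chartSymm p J) fun y hy => ⟨hy.1, mem_univ _⟩

/-- These are the coordinate vector fields of the chart, smooth as the image of constant fields
under the tangent map of the inverse chart. -/
theorem contMDiffOn_chartFrame (J : Set ℝ) (v : 𝔼) :
    ContMDiffOn 𝓘(ℝ, ℝ × 𝔼) ((𝓡 3).prod 𝓘(ℝ, 𝔼)) ∞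
      (fun y : ℝ × 𝔼 => TotalSpace.mk' 𝔼 (E := fun q : S => TangentSpace (𝓡 3) q)
        ((extChartAt (𝓡 3) p).symm y.2) (chartFrame p y.2 v))
      (J ×ˢ (extChartAt (𝓡 3) p).target) := by
  have hV := isOpen_chartTarget p
  have h1 := (contMDiffOn_chartSymm p).contMDiffOn_tangentMapWithin (m := ∞) le_rfl
    hV.uniqueMDiffOn
  have h2 : ContMDiff 𝓘(ℝ, ℝ × 𝔼) (𝓘(ℝ, 𝔼).prod 𝓘(ℝ, 𝔼)) ∞
      (fun y : ℝ × 𝔼 => (⟨y.2, v⟩ : TangentBundle 𝓘(ℝ, 𝔼) 𝔼)) := by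
    have h3 : ContMDiff 𝓘(ℝ, 𝔼) (𝓘(ℝ, 𝔼).prod 𝓘(ℝ, 𝔼)) ∞
        (fun x : 𝔼 => (⟨x, v⟩ : TangentBundle 𝓘(ℝ, 𝔼) 𝔼)) :=
      contMDiff_vectorSpace_iff_contDiff.2 contDiff_const
    exact h3.comp contDiff_snd.contMDiff
  have h4 := h1.comp (h2.contMDiffOn (s := J ×ˢ (extChartAt (𝓡 3) p).target))
    (fun y hy => hy.2)
  refine h4.congr fun y hy => ?_
  simp only [tangentMapWithin, Function.comp_def, chartFrame, chartSymmDeriv]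
  rw [mfderivWithin_of_isOpen hV hy.2]
  rfl

/-- Smoothness into the finite-dimensional dual is tested on constant vectors. There the value is
the contraction of a smooth section of the cotangent bundle with a smooth coordinate field. -/
theorem SmoothOneForms.contDiffOn_chart {J : Set ℝ}
    {α : ℝ → ∀ q : S, TangentSpace (𝓡 3) q →L[ℝ] ℝ} (hα : SmoothOneForms J α) :
    ContDiffOn ℝ ∞ (fun y : ℝ × 𝔼 => pullForm p (α y.1) y.2)
      (J ×ˢ (extChartAt (𝓡 3) p).target) := by
  rw [contDiffOn_clm_apply]
  intro v
  have h1 := ContMDiffOn.comp hα (contMDiffOn_prod_chartSymm p J) fun y hy => ⟨hy.1, mem_univ _⟩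
  have h2 := ContMDiffOn.clm_bundle_apply (F₁ := 𝔼) (F₂ := ℝ)
    (E₁ := fun q : S => TangentSpace (𝓡 3) q) (E₂ := Bundle.Trivial S ℝ) (IB := 𝓡 3)
    (b := fun y : ℝ × 𝔼 => (extChartAt (𝓡 3) p).symm y.2) h1 (contMDiffOn_chartFrame p J v)
  intro y hy
  have h3 := (contMDiffWithinAt_totalSpace.1 (h2 y hy)).2
  exact h3.contDiffWithinAt

end Charts

/-! ### Time, space and exterior derivatives computed in a fixed chart. -/

section ChartDerivatives

open scoped Topology

local notation "𝔼" => EuclideanSpace ℝ (Fin 3)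

variable {S : Type*} [TopologicalSpace S] [ChartedSpace (EuclideanSpace ℝ (Fin 3)) S]
  [IsManifold (𝓡 3) ∞ S] {J : Set ℝ}

theorem fderiv_comp_chartSymm {p : S} {x : 𝔼} (hx : x ∈ (extChartAt (𝓡 3) p).target)
    {φ : S → ℝ} (hφ : MDifferentiableAt (𝓡 3) 𝓘(ℝ, ℝ) φ ((extChartAt (𝓡 3) p).symm x)) (v : 𝔼) :
    fderiv ℝ (fun z => φ ((extChartAt (𝓡 3) p).symm z)) x v
      = mvfderiv (𝓡 3) φ ((extChartAt (𝓡 3) p).symm x) (chartFrame p x v) := by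
  have h := mfderiv_comp x hφ (mdifferentiableAt_chartSymm hx)
  rw [mfderiv_eq_fderiv] at h
  exact congrArg (fun L : 𝔼 →L[ℝ] ℝ => L v) h

omit [IsManifold (𝓡 3) ∞ S] in
theorem SmoothFunctions.mdifferentiableAt (hJ : IsOpen J) {f : ℝ → S → ℝ}
    (hf : SmoothFunctions J f) {t : ℝ} (ht : t ∈ J) (q : S) :
    MDifferentiableAt (𝓡 3) 𝓘(ℝ, ℝ) (f t) q := by
  have h1 : ContMDiffAt (𝓘(ℝ, ℝ).prod (𝓡 3)) 𝓘(ℝ, ℝ) ∞ (fun q : ℝ × S => f q.1 q.2) (t, q) :=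
    ContMDiffOn.contMDiffAt hf ((hJ.prod isOpen_univ).mem_nhds ⟨ht, mem_univ _⟩)
  have h2 : ContMDiffAt (𝓡 3) (𝓘(ℝ, ℝ).prod (𝓡 3)) ∞ (fun q : S => (t, q)) q :=
    contMDiffAt_const.prodMk contMDiffAt_id
  exact (ContMDiffAt.comp q h1 h2).mdifferentiableAt (by simp)

variable {p : S} {t : ℝ} {x : EuclideanSpace ℝ (Fin 3)}

omit [IsManifold (𝓡 3) ∞ S] in
theorem chart_mem_nhds (hJ : IsOpen J) (ht : t ∈ J) (hx : x ∈ (extChartAt (𝓡 3) p).target) :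
    J ×ˢ (extChartAt (𝓡 3) p).target ∈ 𝓝 (t, x) :=
  (hJ.prod (isOpen_chartTarget p)).mem_nhds ⟨ht, hx⟩

theorem fderiv_slice {F : Type*} [NormedAddCommGroup F] [NormedSpace ℝ F] {g : ℝ × 𝔼 → F}
    (hg : DifferentiableAt ℝ g (t, x)) (v : 𝔼) :
    fderiv ℝ g (t, x) (0, v) = fderiv ℝ (fun z => g (t, z)) x v := by
  have h : HasFDerivAt (fun z => g (t, z)) _ x :=
    hg.hasFDerivAt.comp x (hasFDerivAt_prodMk_right t x)
  rw [h.fderiv]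
  simp

theorem hasDerivAt_slice {F : Type*} [NormedAddCommGroup F] [NormedSpace ℝ F] {g : ℝ × 𝔼 → F}
    (hg : DifferentiableAt ℝ g (t, x)) :
    HasDerivAt (fun s => g (s, x)) (fderiv ℝ g (t, x) (1, 0)) t := by
  have h : HasFDerivAt (fun s => g (s, x)) _ t :=
    hg.hasFDerivAt.comp t (hasFDerivAt_prodMk_left t x)
  simpa using h.hasDerivAt

section Functions

variable {f : ℝ → S → ℝ} (hJ : IsOpen J) (hf : SmoothFunctions J f) (ht : t ∈ J)
  (hx : x ∈ (extChartAt (𝓡 3) p).target)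
include hJ hf ht hx

theorem SmoothFunctions.differentiableAt_chart :
    DifferentiableAt ℝ (fun y : ℝ × 𝔼 => f y.1 ((extChartAt (𝓡 3) p).symm y.2)) (t, x) :=
  ((hf.contDiffOn_chart p).contDiffAt (chart_mem_nhds hJ ht hx)).differentiableAt (by simp)

theorem SmoothFunctions.fderiv_chart_space (v : 𝔼) :
    fderiv ℝ (fun y : ℝ × 𝔼 => f y.1 ((extChartAt (𝓡 3) p).symm y.2)) (t, x) (0, v)
      = mvfderiv (𝓡 3) (f t) ((extChartAt (𝓡 3) p).symm x) (chartFrame p x v) := by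
  rw [fderiv_slice (hf.differentiableAt_chart hJ ht hx)]
  exact fderiv_comp_chartSymm hx (hf.mdifferentiableAt hJ ht _) v

theorem SmoothFunctions.fderiv_chart_time :
    fderiv ℝ (fun y : ℝ × 𝔼 => f y.1 ((extChartAt (𝓡 3) p).symm y.2)) (t, x) (1, 0)
      = deriv (fun s => f s ((extChartAt (𝓡 3) p).symm x)) t :=
  (hasDerivAt_slice (hf.differentiableAt_chart hJ ht hx)).deriv.symm

end Functions

section Forms

variable {α : ℝ → ∀ q : S, TangentSpace (𝓡 3) q →L[ℝ] ℝ} (hJ : IsOpen J)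
  (hα : SmoothOneForms J α) (ht : t ∈ J) (hx : x ∈ (extChartAt (𝓡 3) p).target)
include hJ hα ht hx

theorem SmoothOneForms.differentiableAt_chart :
    DifferentiableAt ℝ (fun y : ℝ × 𝔼 => pullForm p (α y.1) y.2) (t, x) :=
  ((hα.contDiffOn_chart p).contDiffAt (chart_mem_nhds hJ ht hx)).differentiableAt (by simp)

/-- At a fixed point of `S` the chart expression is composition with an isomorphism independent of
time, which `chartCoframe` undoes. -/
theorem SmoothOneForms.hasDerivAt :
    HasDerivAt (F := 𝔼 →L[ℝ] ℝ) (fun s => α s ((extChartAt (𝓡 3) p).symm x))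
      ((fderiv ℝ (fun y : ℝ × 𝔼 => pullForm p (α y.1) y.2) (t, x) (1, 0)).comp
        (chartCoframe p x)) t := by
  have h := (hasDerivAt_slice (hα.differentiableAt_chart hJ ht hx)).clm_comp
    (hasDerivAt_const t (chartCoframe p x))
  simp only [ContinuousLinearMap.comp_zero, add_zero] at h
  refine h.congr_of_eventuallyEq (Filter.Eventually.of_forall fun s => ?_)
  exact ContinuousLinearMap.ext fun v =>
    (congrArg (fun w : 𝔼 => α s ((extChartAt (𝓡 3) p).symm x) w)
      (chartFrame_chartCoframe hx v)).symm

theorem SmoothOneForms.fderiv_chart_time (v : 𝔼) :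
    fderiv ℝ (fun y : ℝ × 𝔼 => pullForm p (α y.1) y.2) (t, x) (1, 0) v
      = deriv (fun s => α s ((extChartAt (𝓡 3) p).symm x)) t (chartFrame p x v) := by
  have h := (hα.hasDerivAt hJ ht hx).deriv
  have h2 := congrArg (fun L : 𝔼 →L[ℝ] ℝ => L (chartFrame p x v)) h
  simp only [ContinuousLinearMap.comp_apply, chartCoframe_chartFrame hx] at h2
  exact h2.symm

omit hJ hα ht in
/-- The differential of a change of charts. -/
theorem chart_transition {q : S} (hq : (extChartAt (𝓡 3) p).symm x ∈ (extChartAt (𝓡 3) q).source) :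
    ContDiffAt ℝ ∞ (fun z => extChartAt (𝓡 3) q ((extChartAt (𝓡 3) p).symm z)) x ∧
    (∀ v, fderiv ℝ (fun z => extChartAt (𝓡 3) q ((extChartAt (𝓡 3) p).symm z)) x v
      = mfderiv (𝓡 3) 𝓘(ℝ, 𝔼) (extChartAt (𝓡 3) q) ((extChartAt (𝓡 3) p).symm x)
        (chartFrame p x v)) := by
  have := isManifold_one (S := S)
  constructor
  · rw [← contMDiffAt_iff_contDiffAt]
    have h1 : ContMDiffAt (𝓡 3) 𝓘(ℝ, 𝔼) ∞ (extChartAt (𝓡 3) q)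
        ((extChartAt (𝓡 3) p).symm x) :=
      contMDiffAt_extChartAt' (by simpa [extChartAt_source] using hq)
    exact ContMDiffAt.comp x h1 ((contMDiffOn_chartSymm p).contMDiffAt
      ((isOpen_chartTarget p).mem_nhds hx))
  · intro v
    have h1 : MDifferentiableAt (𝓡 3) 𝓘(ℝ, 𝔼) (extChartAt (𝓡 3) q)
        ((extChartAt (𝓡 3) p).symm x) :=
      mdifferentiableAt_extChartAt (by simpa [extChartAt_source] using hq)
    have h := mfderiv_comp x h1 (mdifferentiableAt_chartSymm hx)
    rw [mfderiv_eq_fderiv] at h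
    exact congrArg (fun L : 𝔼 →L[ℝ] 𝔼 => L v) h

omit hJ hα ht in
theorem pullForm_transition {q : S}
    (hq : (extChartAt (𝓡 3) p).symm x ∈ (extChartAt (𝓡 3) q).source) (γ : S → 𝔼 →L[ℝ] ℝ) :
    pullForm p γ x
      = (pullForm q γ (extChartAt (𝓡 3) q ((extChartAt (𝓡 3) p).symm x))).comp
        (fderiv ℝ (fun z => extChartAt (𝓡 3) q ((extChartAt (𝓡 3) p).symm z)) x) := by
  have := isManifold_one (S := S)
  have ht := (extChartAt (𝓡 3) q).map_source hq
  have hl := (extChartAt (𝓡 3) q).left_inv hq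
  ext v
  have h1 := chartFrame_chartCoframe ht (chartFrame p x v)
  rw [chartCoframe, hl] at h1
  simp only [pullForm, ContinuousLinearMap.comp_apply]
  rw [(chart_transition hx hq).2 v, hl]
  exact congrArg _ h1.symm

/-- `extD` at q uses the preferred chart at q, which varies with q, whereas the coordinate flow
lives in the single chart at p. The exterior derivative is natural under the transition map, so the
two computations agree. -/
theorem SmoothOneForms.extD_eq (v w : 𝔼) :
    fderiv ℝ (fun y : ℝ × 𝔼 => pullForm p (α y.1) y.2) (t, x) (0, v) w
      - fderiv ℝ (fun y : ℝ × 𝔼 => pullForm p (α y.1) y.2) (t, x) (0, w) v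
      = extD (𝓡 3) (α t) ((extChartAt (𝓡 3) p).symm x) (chartFrame p x v) (chartFrame p x w) := by
  have := isManifold_one (S := S)
  set q := (extChartAt (𝓡 3) p).symm x with hq
  have hqs : q ∈ (extChartAt (𝓡 3) q).source := mem_extChartAt_source q
  have hqt : extChartAt (𝓡 3) q q ∈ (extChartAt (𝓡 3) q).target := mem_extChartAt_target q
  have hτ := chart_transition hx (q := q) hqs
  have hd : DifferentiableAt ℝ (pullForm q (α t)) (extChartAt (𝓡 3) q q) :=
    (hα.differentiableAt_chart hJ ht hqt).comp (extChartAt (𝓡 3) q q)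
      (hasFDerivAt_prodMk_right t _).differentiableAt
  have hD := hα.differentiableAt_chart hJ ht hx
  rw [fderiv_slice hD, fderiv_slice hD]
  change dForm (pullForm p (α t)) x v w = _
  have ev : pullForm p (α t) =ᶠ[𝓝 x] fun z =>
      (pullForm q (α t) (extChartAt (𝓡 3) q ((extChartAt (𝓡 3) p).symm z))).comp
        (fderiv ℝ (fun z => extChartAt (𝓡 3) q ((extChartAt (𝓡 3) p).symm z)) z) := by
    have h1 : ∀ᶠ z in 𝓝 x, (extChartAt (𝓡 3) p).symm z ∈ (extChartAt (𝓡 3) q).source :=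
      (mdifferentiableAt_chartSymm hx).continuousAt
        ((isOpen_extChartAt_source q).mem_nhds hqs)
    filter_upwards [h1, (isOpen_chartTarget p).mem_nhds hx] with z hz hz'
      using pullForm_transition hz' hz (α t)
  rw [dForm_congr ev, dForm_pullback (hτ.1.of_le two_le_infty) hd, hτ.2 v, hτ.2 w]
  have key : ∀ a b : 𝔼, fderiv ℝ (fun z => α t ((extChartAt (𝓡 3) q).symm z)
      (chartSymmDeriv (𝓡 3) q z b)) (extChartAt (𝓡 3) q q) a
      = fderiv ℝ (pullForm q (α t)) (extChartAt (𝓡 3) q q) a b :=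
    fun a b => fderiv_form_apply hd b a
  exact (congrArg₂ (· - ·) (key _ _) (key _ _)).symm

end Forms

end ChartDerivatives

/-! ### Linear algebra of a coframe, its dual frame and its metric. -/

section DualFrames

variable {E : Type*} [NormedAddCommGroup E] [NormedSpace ℝ E] {ι : Type*} [Fintype ι]
  [DecidableEq ι]

/-- The metric for which the coframe `e` is orthonormal. -/
def coframeMetric (e : ι → E →L[ℝ] ℝ) : E →L[ℝ] E →L[ℝ] ℝ :=
  ∑ a, (e a).smulRight (e a)

omit [DecidableEq ι] in
theorem coframeMetric_apply (e : ι → E →L[ℝ] ℝ) (v w : E) :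
    coframeMetric e v w = ∑ a, e a v * e a w := by
  simp [coframeMetric]

theorem exists_dual_frame [FiniteDimensional ℝ E] {e : ι → E →L[ℝ] ℝ}
    (he : LinearIndependent ℝ e) (hcard : Fintype.card ι = Module.finrank ℝ E) :
    ∃ X : ι → E, ∀ a c, e a (X c) = if a = c then 1 else 0 := by
  have he' : LinearIndependent ℝ (fun a => (e a : Module.Dual ℝ E)) :=
    he.map' (ContinuousLinearMap.coeLM ℝ) (LinearMap.ker_eq_bot.2
      ContinuousLinearMap.coe_injective)
  have hspan := he'.span_eq_top_of_card_eq_finrank' (hcard.trans Subspace.dual_finrank_eq.symm)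
  let b := Module.Basis.mk he' hspan.ge
  refine ⟨fun c => (Module.evalEquiv ℝ E).symm (b.dualBasis c), fun a c => ?_⟩
  have h := Module.apply_evalEquiv_symm_apply ℝ E (e a : Module.Dual ℝ E) (b.dualBasis c)
  have h2 : b a = (e a : Module.Dual ℝ E) := Module.Basis.mk_apply _ _ a
  rw [← h2, Module.Basis.dualBasis_apply_self, h2] at h
  exact h

variable [FiniteDimensional ℝ E] {e : ι → E →L[ℝ] ℝ} {X : ι → E}
  (hX : ∀ a c, e a (X c) = if a = c then 1 else 0)
  (hcard : Fintype.card ι = Module.finrank ℝ E)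
include hX

omit [FiniteDimensional ℝ E] in
theorem linearIndependent_frame : LinearIndependent ℝ X := by
  rw [Fintype.linearIndependent_iff]
  intro g hg a
  simpa [hX] using congrArg (e a) hg

include hcard

/-- The basis formed by the dual frame. -/
theorem exists_frame_basis : ∃ b : Module.Basis ι ℝ E, ∀ a, b a = X a ∧
    ∀ v, b.repr v a = e a v := by
  have hli := linearIndependent_frame hX
  have hspan := hli.span_eq_top_of_card_eq_finrank' hcard
  let b := Module.Basis.mk hli hspan.ge
  have hb : ∀ c, b c = X c := fun c => Module.Basis.mk_apply _ _ c
  refine ⟨b, fun a => ⟨hb a, fun v => ?_⟩⟩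
  have : b.coord a = (e a : E →ₗ[ℝ] ℝ) := by
    refine b.ext fun c => ?_
    rw [Module.Basis.coord_apply, Module.Basis.repr_self, ContinuousLinearMap.coe_coe, hb, hX]
    simp [Finsupp.single_apply, eq_comm]
  exact congrArg (fun L : E →ₗ[ℝ] ℝ => L v) this

theorem sum_coframe_smul_frame (v : E) : ∑ a, e a v • X a = v := by
  obtain ⟨b, hb⟩ := exists_frame_basis hX hcard
  conv_rhs => rw [← b.sum_repr v]
  exact Finset.sum_congr rfl fun a _ => by rw [(hb a).1, (hb a).2]

theorem form_eq_sum (φ : E →L[ℝ] ℝ) (v : E) : φ v = ∑ a, φ (X a) * e a v := by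
  conv_lhs => rw [← sum_coframe_smul_frame hX hcard v]
  simp [mul_comm]

/-- `ContinuousLinearMap.inverse` is zero on a map that is not invertible. An explicit two-sided
inverse shows that the musical isomorphism here is the genuine one. -/
theorem inverse_coframeMetric_apply (φ : E →L[ℝ] ℝ) :
    (coframeMetric e).inverse φ = ∑ a, φ (X a) • X a := by
  have h : (coframeMetric e).inverse
      = ∑ a, (ContinuousLinearMap.apply ℝ ℝ (X a)).smulRight (X a) := by
    apply ContinuousLinearMap.inverse_eq
    · ext φ v
      simp [coframeMetric_apply, hX, form_eq_sum hX hcard φ v]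
    · ext v
      conv_rhs => rw [ContinuousLinearMap.id_apply, ← sum_coframe_smul_frame hX hcard v]
      simp [coframeMetric_apply, hX]
  simp [h]

theorem isInvertible_coframeMetric : (coframeMetric e).IsInvertible := by
  refine ContinuousLinearMap.IsInvertible.of_inverse
    (g := ∑ a, (ContinuousLinearMap.apply ℝ ℝ (X a)).smulRight (X a)) ?_ ?_
  · ext φ v
    simp [coframeMetric_apply, hX, form_eq_sum hX hcard φ v]
  · ext v
    conv_rhs => rw [ContinuousLinearMap.id_apply, ← sum_coframe_smul_frame hX hcard v]
    simp [coframeMetric_apply, hX]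

theorem inverse_coframeMetric_coframe (a : ι) : (coframeMetric e).inverse (e a) = X a := by
  simp [inverse_coframeMetric_apply hX hcard, hX]

theorem trace_eq_sum_coframe (L : E →ₗ[ℝ] E) : LinearMap.trace ℝ E L = ∑ a, e a (L (X a)) := by
  obtain ⟨b, hb⟩ := exists_frame_basis hX hcard
  rw [LinearMap.trace_eq_matrix_trace ℝ b, Matrix.trace]
  refine Finset.sum_congr rfl fun a _ => ?_
  rw [Matrix.diag_apply, LinearMap.toMatrix_apply, (hb a).2, (hb a).1]

theorem trace_inverse_comp (B : E →L[ℝ] E →L[ℝ] ℝ) :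
    LinearMap.trace ℝ E ((coframeMetric e).inverse ∘L B : E →L[ℝ] E) = ∑ a, B (X a) (X a) := by
  rw [trace_eq_sum_coframe hX hcard]
  simp [inverse_coframeMetric_apply hX hcard, hX]

theorem trace_inverse_comp_sq (B : E →L[ℝ] E →L[ℝ] ℝ) :
    LinearMap.trace ℝ E (((coframeMetric e).inverse ∘L B) ∘L ((coframeMetric e).inverse ∘L B)
      : E →L[ℝ] E) = ∑ a, ∑ c, B (X a) (X c) * B (X c) (X a) := by
  rw [trace_eq_sum_coframe hX hcard]
  simp [inverse_coframeMetric_apply hX hcard, hX]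

end DualFrames

/-! ### Differentiating the metric of a coframe; smoothness of the dual frame. -/

section CoframeCalculus

set_option synthInstance.maxHeartbeats 200000

variable {E : Type*} [NormedAddCommGroup E] [NormedSpace ℝ E]

theorem hasDerivAt_smulRight_self {e : ℝ → E →L[ℝ] ℝ} {e' : E →L[ℝ] ℝ} {t : ℝ}
    (he : HasDerivAt e e' t) :
    HasDerivAt (fun s => (e s).smulRight (e s)) ((e t).smulRight e' + e'.smulRight (e t)) t := by
  have := ContinuousLinearMap.hasDerivAt_of_bilinear (x := t) (u := e) (v := e)
    (G := E →L[ℝ] E →L[ℝ] ℝ) (B := ContinuousLinearMap.smulRightL ℝ E (E →L[ℝ] ℝ))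
    (fun _ => he) (fun _ => he)
  exact this

theorem deriv_coframeMetric_apply {ι : Type*} [Fintype ι] {e : ι → ℝ → E →L[ℝ] ℝ}
    {e' : ι → E →L[ℝ] ℝ} {t : ℝ} (he : ∀ a, HasDerivAt (e a) (e' a) t) (v w : E) :
    deriv (fun s => coframeMetric fun a => e a s) t v w
      = ∑ a, (e a t v * e' a w + e' a v * e a t w) := by
  have h : HasDerivAt (fun s => ∑ a, (e a s).smulRight (e a s))
      (∑ a, ((e a t).smulRight (e' a) + (e' a).smulRight (e a t))) t :=
    HasDerivAt.fun_sum (F := E →L[ℝ] E →L[ℝ] ℝ) (A := fun a s => (e a s).smulRight (e a s))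
      (A' := fun a => (e a t).smulRight (e' a) + (e' a).smulRight (e a t)) fun a _ =>
      hasDerivAt_smulRight_self (he a)
  have h1 := HasDerivAt.deriv (𝕜 := ℝ) (F := E →L[ℝ] E →L[ℝ] ℝ) h
  have h2 : deriv (fun s => coframeMetric fun a => e a s) t
      = ∑ a, ((e a t).smulRight (e' a) + (e' a).smulRight (e a t)) := h1
  simp [h2]

theorem contDiffOn_coframeMetric {ι : Type*} [Fintype ι] {Y : Type*} [NormedAddCommGroup Y]
    [NormedSpace ℝ Y] {U : Set Y} {e : ι → Y → E →L[ℝ] ℝ}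
    (he : ∀ a, ContDiffOn ℝ ∞ (e a) U) :
    ContDiffOn ℝ ∞ (fun y => coframeMetric (fun a => e a y)) U :=
  ContDiffOn.sum (F := E →L[ℝ] E →L[ℝ] ℝ) fun a _ => (he a).smulRight (he a)

/-- The dual frame is the coframe raised by the metric, and inversion of operators is smooth at
invertible ones. -/
theorem contDiffOn_dual_frame [FiniteDimensional ℝ E] {ι : Type*} [Fintype ι] [DecidableEq ι]
    (hcard : Fintype.card ι = Module.finrank ℝ E)
    {Y : Type*} [NormedAddCommGroup Y] [NormedSpace ℝ Y] {U : Set Y}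
    {e : ι → Y → E →L[ℝ] ℝ} {X : ι → Y → E} (he : ∀ a, ContDiffOn ℝ ∞ (e a) U)
    (hX : ∀ y ∈ U, ∀ a c, e a y (X c y) = if a = c then 1 else 0) (a : ι) :
    ContDiffOn ℝ ∞ (X a) U := by
  have := FiniteDimensional.complete ℝ E
  have h2 : ContDiffOn ℝ ∞ (fun y => (coframeMetric (fun a => e a y)).inverse) U := fun y hy =>
    ContDiffAt.comp_contDiffWithinAt (F := E →L[ℝ] E →L[ℝ] ℝ) (G := (E →L[ℝ] ℝ) →L[ℝ] E)
      (g := ContinuousLinearMap.inverse) y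
      (isInvertible_coframeMetric (hX y hy) hcard).contDiffAt_map_inverse
      (contDiffOn_coframeMetric he y hy)
  exact (h2.clm_apply (he a)).congr fun y hy =>
    (inverse_coframeMetric_coframe (hX y hy) hcard a).symm

end CoframeCalculus

/-! ### Pointwise frame components of Θ and dβ on `S`. -/

section FamilyFrames

open scoped Topology

local notation "𝔼" => EuclideanSpace ℝ (Fin 3)

theorem card_eq_finrank : Fintype.card (Fin 3) = Module.finrank ℝ 𝔼 := by simp

variable {S : Type*} [TopologicalSpace S] [ChartedSpace (EuclideanSpace ℝ (Fin 3)) S]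

namespace Family

variable (F : Family S)

/-- The coframe `(e_u, e_l, e_n)`. -/
def cof : Fin 3 → ℝ → S → 𝔼 →L[ℝ] ℝ
  | 0 => F.eu
  | 1 => F.el
  | 2 => F.en

/-- The frame metrically dual to the coframe. -/
def vec (a : Fin 3) (t : ℝ) (p : S) : 𝔼 := sharp (F.h t p) (F.cof a t p)

/-- The components of the second fundamental form. -/
def ΘComp (a c : Fin 3) (t : ℝ) (p : S) : ℝ := F.Θ t p (F.vec a t p) (F.vec c t p)

/-- The components of `dβ`. -/
def dβComp (a : Fin 3) (t : ℝ) (p : S) : ℝ := F.dβOf t p (F.cof a t p)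

theorem h_eq (t : ℝ) (p : S) : F.h t p = coframeMetric (fun a => F.cof a t p) := by
  rw [coframeMetric, Fin.sum_univ_three]
  rfl

end Family

variable [IsManifold (𝓡 3) ∞ S] {lam : ℝ} {J : Set ℝ} {F : Family S}

namespace IsKillingSpinorialFlow

variable (hF : IsKillingSpinorialFlow lam J F) {t : ℝ} (ht : t ∈ J) (q : S)
include hF

theorem smooth_cof (a : Fin 3) : SmoothOneForms J (F.cof a) := by
  fin_cases a
  · exact hF.smooth_eu
  · exact hF.smooth_el
  · exact hF.smooth_en

include ht

theorem linearIndependent_cof : LinearIndependent ℝ (fun a => F.cof a t q) := by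
  have h := hF.coframe t ht q
  have e : (fun a => F.cof a t q) = ![F.eu t q, F.el t q, F.en t q] := by
    funext a; fin_cases a <;> rfl
  rw [e]
  exact h

theorem cof_vec (a c : Fin 3) : F.cof a t q (F.vec c t q) = if a = c then 1 else 0 := by
  obtain ⟨X, hX⟩ := exists_dual_frame (hF.linearIndependent_cof ht q) card_eq_finrank
  have : F.vec c t q = X c := by
    rw [Family.vec, F.h_eq]
    exact inverse_coframeMetric_coframe hX card_eq_finrank c
  rw [this, hX]

theorem ΘOf_apply (a : Fin 3) (v : 𝔼) :
    F.ΘOf t q (F.cof a t q) v = ∑ c, F.ΘComp a c t q * F.cof c t q v :=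
  form_eq_sum (hF.cof_vec ht q) card_eq_finrank _ v

theorem dβ_apply (v : 𝔼) : F.dβ t q v = ∑ a, F.dβComp a t q * F.cof a t q v :=
  form_eq_sum (hF.cof_vec ht q) card_eq_finrank _ v

theorem traceWrt_eq : traceWrt (F.h t q) (F.Θ t q) = ∑ a, F.ΘComp a a t q := by
  rw [F.h_eq]
  exact trace_inverse_comp (hF.cof_vec ht q) card_eq_finrank _

theorem normSqWrt_eq :
    normSqWrt (F.h t q) (F.Θ t q) = ∑ a, ∑ c, F.ΘComp a c t q * F.ΘComp c a t q := by
  rw [F.h_eq]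
  exact trace_inverse_comp_sq (hF.cof_vec ht q) card_eq_finrank _

end IsKillingSpinorialFlow

end FamilyFrames

/-! ### The Killing spinorial flow read in a chart. -/

section FamilyInChart

open scoped Topology

local notation "𝔼" => EuclideanSpace ℝ (Fin 3)

variable {S : Type*} [TopologicalSpace S] [ChartedSpace (EuclideanSpace ℝ (Fin 3)) S]

namespace Family

variable (F : Family S) (p : S)

/-- The lapse function in the preferred chart at `p`. -/
def βChart (y : ℝ × 𝔼) : ℝ := F.β y.1 ((extChartAt (𝓡 3) p).symm y.2)

/-- The coframe in the preferred chart at `p`. -/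
def cofChart (a : Fin 3) (y : ℝ × 𝔼) : 𝔼 →L[ℝ] ℝ := pullForm p (F.cof a y.1) y.2

/-- The frame in the preferred chart at `p`. -/
def vecChart (a : Fin 3) (y : ℝ × 𝔼) : 𝔼 :=
  chartCoframe p y.2 (F.vec a y.1 ((extChartAt (𝓡 3) p).symm y.2))

/-- The components of the second fundamental form in the preferred chart at `p`. -/
def ΘChart (a c : Fin 3) (y : ℝ × 𝔼) : ℝ := F.ΘComp a c y.1 ((extChartAt (𝓡 3) p).symm y.2)

/-- The components of `dβ` in the preferred chart at `p`. -/
def dβChart (a : Fin 3) (y : ℝ × 𝔼) : ℝ := F.dβComp a y.1 ((extChartAt (𝓡 3) p).symm y.2)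

end Family

variable [IsManifold (𝓡 3) ∞ S] {lam : ℝ} {J : Set ℝ} {F : Family S}

namespace IsKillingSpinorialFlow

variable (hF : IsKillingSpinorialFlow lam J F) (hJ : IsOpen J) (p : S)
include hF

theorem contDiffOn_βChart :
    ContDiffOn ℝ ∞ (F.βChart p) (J ×ˢ (extChartAt (𝓡 3) p).target) :=
  hF.smooth_β.contDiffOn_chart p

theorem contDiffOn_cofChart (a : Fin 3) :
    ContDiffOn ℝ ∞ (F.cofChart p a) (J ×ˢ (extChartAt (𝓡 3) p).target) :=
  (hF.smooth_cof a).contDiffOn_chart p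

variable {p} {y : ℝ × EuclideanSpace ℝ (Fin 3)} (hy : y ∈ J ×ˢ (extChartAt (𝓡 3) p).target)
include hy

omit hF in
theorem chartFrame_vecChart (a : Fin 3) :
    chartFrame p y.2 (F.vecChart p a y) = F.vec a y.1 ((extChartAt (𝓡 3) p).symm y.2) :=
  chartFrame_chartCoframe hy.2 _

theorem cofChart_vecChart (a c : Fin 3) :
    F.cofChart p a y (F.vecChart p c y) = if a = c then 1 else 0 := by
  rw [← hF.cof_vec hy.1 ((extChartAt (𝓡 3) p).symm y.2) a c, ← chartFrame_vecChart hy c]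
  rfl

theorem βChart_pos : 0 < F.βChart p y := hF.β_pos _ hy.1 _

omit hy in
variable (p) in
theorem contDiffOn_vecChart (a : Fin 3) :
    ContDiffOn ℝ ∞ (F.vecChart p a) (J ×ˢ (extChartAt (𝓡 3) p).target) :=
  contDiffOn_dual_frame card_eq_finrank (hF.contDiffOn_cofChart p)
    (fun _ hy => hF.cofChart_vecChart hy) a

include hJ

/-- The second fundamental form in terms of the time derivative of the coframe. -/
theorem ΘChart_eq (a c : Fin 3) :
    F.ΘChart p a c y = -(1 / (2 * F.βChart p y))
      * (fderiv ℝ (F.cofChart p a) y (1, 0) (F.vecChart p c y)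
        + fderiv ℝ (F.cofChart p c) y (1, 0) (F.vecChart p a y)) := by
  obtain ⟨t, x⟩ := y
  obtain ⟨ht, hx⟩ := hy
  set q := (extChartAt (𝓡 3) p).symm x with hq
  set D : Fin 3 → 𝔼 →L[ℝ] ℝ := fun b =>
    (fderiv ℝ (F.cofChart p b) (t, x) (1, 0)).comp (chartCoframe p x) with hD
  have h1 : ∀ b, HasDerivAt (fun s => F.cof b s q) (D b) t := fun b =>
    (hF.smooth_cof b).hasDerivAt hJ ht hx
  have h2 := deriv_coframeMetric_apply h1 (F.vec a t q) (F.vec c t q)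
  have h3 : F.ΘChart p a c (t, x) = -(1 / (2 * F.βChart p (t, x)))
      * deriv (fun s => coframeMetric fun b => F.cof b s q) t (F.vec a t q) (F.vec c t q) := by
    simp only [← F.h_eq]
    rfl
  rw [h3, h2]
  simp only [hF.cof_vec ht q]
  simp [Finset.sum_add_distrib, hD, Family.vecChart, hq]

theorem ΘChart_symm (a c : Fin 3) : F.ΘChart p a c y = F.ΘChart p c a y := by
  rw [hF.ΘChart_eq hJ hy, hF.ΘChart_eq hJ hy, add_comm]

theorem dβChart_eq (a : Fin 3) :
    F.dβChart p a y = fderiv ℝ (F.βChart p) y (0, F.vecChart p a y) := by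
  rw [show F.βChart p = fun y : ℝ × 𝔼 => F.β y.1 ((extChartAt (𝓡 3) p).symm y.2) from rfl,
    hF.smooth_β.fderiv_chart_space hJ hy.1 hy.2, chartFrame_vecChart hy]
  rfl

omit hy in
variable (p) in
theorem contDiffOn_ΘChart (a c : Fin 3) :
    ContDiffOn ℝ ∞ (F.ΘChart p a c) (J ×ˢ (extChartAt (𝓡 3) p).target) := by
  have hU := hJ.prod (isOpen_chartTarget p)
  have h1 : ∀ a c, ContDiffOn ℝ ∞
      (fun y => fderiv ℝ (F.cofChart p a) y (1, 0) (F.vecChart p c y))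
      (J ×ˢ (extChartAt (𝓡 3) p).target) := fun a c =>
    (((hF.contDiffOn_cofChart p a).fderiv_of_isOpen hU le_rfl).clm_apply
      contDiffOn_const).clm_apply (hF.contDiffOn_vecChart p c)
  have h2 : ContDiffOn ℝ ∞ (fun y => -(1 / (2 * F.βChart p y)))
      (J ×ˢ (extChartAt (𝓡 3) p).target) :=
    (contDiffOn_const.div (contDiffOn_const.mul (hF.contDiffOn_βChart p)) fun y hy =>
      mul_ne_zero two_ne_zero (hF.βChart_pos hy).ne').neg
  exact (h2.mul ((h1 a c).add (h1 c a))).congr fun y hy => hF.ΘChart_eq hJ hy a c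

omit hy in
variable (p) in
theorem contDiffOn_dβChart (a : Fin 3) :
    ContDiffOn ℝ ∞ (F.dβChart p a) (J ×ˢ (extChartAt (𝓡 3) p).target) := by
  have hU := hJ.prod (isOpen_chartTarget p)
  exact (((hF.contDiffOn_βChart p).fderiv_of_isOpen hU le_rfl).clm_apply
    (contDiffOn_const.prodMk (hF.contDiffOn_vecChart p a))).congr fun y hy => hF.dβChart_eq hJ hy a

omit hJ in
theorem ΘOf_chartFrame (a : Fin 3) (v : 𝔼) :
    F.ΘOf y.1 ((extChartAt (𝓡 3) p).symm y.2) (F.cof a y.1 ((extChartAt (𝓡 3) p).symm y.2))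
      (chartFrame p y.2 v) = ∑ c, F.ΘChart p a c y * F.cofChart p c y v :=
  hF.ΘOf_apply hy.1 _ a _

theorem fderiv_βChart_eq (v : 𝔼) : fderiv ℝ (F.βChart p) y (0, v)
    = F.dβ y.1 ((extChartAt (𝓡 3) p).symm y.2) (chartFrame p y.2 v) :=
  hF.smooth_β.fderiv_chart_space hJ hy.1 hy.2 v

theorem fderiv_βChart_space (v : 𝔼) :
    fderiv ℝ (F.βChart p) y (0, v) = ∑ a, F.dβChart p a y * F.cofChart p a y v :=
  (hF.fderiv_βChart_eq hJ hy v).trans (hF.dβ_apply hy.1 _ _)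

theorem fderiv_cofChart_time (a : Fin 3) (v : 𝔼) :
    fderiv ℝ (F.cofChart p a) y (1, 0) v
      = deriv (fun s => F.cof a s ((extChartAt (𝓡 3) p).symm y.2)) y.1 (chartFrame p y.2 v) :=
  (hF.smooth_cof a).fderiv_chart_time hJ hy.1 hy.2 v

-- Each coordinate equation is the invariant equation evaluated on coordinate vectors of the chart.
-- Only the equations for de_a also need the chart independence of the exterior derivative.
omit hy in
variable (p) in
theorem flowInCoordinates {f : ℝ → S → ℝ} (hf : IsPotential lam J F f) :
    FlowInCoordinates lam (F.βChart p) (F.cofChart p) (F.vecChart p) (F.ΘChart p) (F.dβChart p)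
      (fun y => f y.1 ((extChartAt (𝓡 3) p).symm y.2)) (J ×ˢ (extChartAt (𝓡 3) p).target) where
  isOpen := hJ.prod (isOpen_chartTarget p)
  smooth_β := hF.contDiffOn_βChart p
  smooth_e := hF.contDiffOn_cofChart p
  smooth_X := hF.contDiffOn_vecChart p
  smooth_T := hF.contDiffOn_ΘChart hJ p
  smooth_s := hF.contDiffOn_dβChart hJ p
  smooth_f := hf.smooth.contDiffOn_chart p
  β_ne y hy := (hF.βChart_pos hy).ne'
  dual y hy := hF.cofChart_vecChart hy
  T_symm y hy := hF.ΘChart_symm hJ hy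
  dβ y hy := hF.fderiv_βChart_space hJ hy
  evol_eu y hy v := by
    have h := congrArg (fun L : 𝔼 →L[ℝ] ℝ => L (chartFrame p y.2 v))
      (hF.evol_eu y.1 hy.1 ((extChartAt (𝓡 3) p).symm y.2))
    rw [hF.fderiv_cofChart_time hJ hy, ← hF.ΘOf_chartFrame hy, hF.fderiv_βChart_eq hJ hy]
    exact h
  evol_el y hy v := by
    have h := congrArg (fun L : 𝔼 →L[ℝ] ℝ => L (chartFrame p y.2 v))
      (hF.evol_el y.1 hy.1 ((extChartAt (𝓡 3) p).symm y.2))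
    rw [hF.fderiv_cofChart_time hJ hy, ← hF.ΘOf_chartFrame hy]
    exact h
  evol_en y hy v := by
    have h := congrArg (fun L : 𝔼 →L[ℝ] ℝ => L (chartFrame p y.2 v))
      (hF.evol_en y.1 hy.1 ((extChartAt (𝓡 3) p).symm y.2))
    rw [hF.fderiv_cofChart_time hJ hy, ← hF.ΘOf_chartFrame hy]
    exact h
  d_eu y hy v w := by
    have h := hF.d_eu y.1 hy.1 ((extChartAt (𝓡 3) p).symm y.2) (chartFrame p y.2 v)
      (chartFrame p y.2 w)
    rw [← hF.ΘOf_chartFrame hy, ← hF.ΘOf_chartFrame hy]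
    exact ((hF.smooth_cof 0).extD_eq hJ hy.1 hy.2 v w).trans h
  d_el y hy v w := by
    have h := hF.d_el y.1 hy.1 ((extChartAt (𝓡 3) p).symm y.2) (chartFrame p y.2 v)
      (chartFrame p y.2 w)
    rw [← hF.ΘOf_chartFrame hy, ← hF.ΘOf_chartFrame hy]
    exact ((hF.smooth_cof 1).extD_eq hJ hy.1 hy.2 v w).trans h
  d_en y hy v w := by
    have h := hF.d_en y.1 hy.1 ((extChartAt (𝓡 3) p).symm y.2) (chartFrame p y.2 v)
      (chartFrame p y.2 w)
    rw [← hF.ΘOf_chartFrame hy, ← hF.ΘOf_chartFrame hy]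
    exact (congrArg (· + _) ((hF.smooth_cof 2).extD_eq hJ hy.1 hy.2 v w)).trans h
  df_space y hy v := by
    have h := congrArg (fun L : 𝔼 →L[ℝ] ℝ => L (chartFrame p y.2 v))
      (hf.d_space y.1 hy.1 ((extChartAt (𝓡 3) p).symm y.2))
    rw [← hF.ΘOf_chartFrame hy]
    exact (hf.smooth.fderiv_chart_space hJ hy.1 hy.2 v).trans h
  df_time y hy :=
    (hf.smooth.fderiv_chart_time hJ hy.1 hy.2).trans (hf.d_time _ hy.1 _)

end IsKillingSpinorialFlow

end FamilyInChart

/-! ### The Lorentzian metric in product charts and its Ricci tensor. -/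

section Spacetime

open scoped Topology

local notation "𝔼" => EuclideanSpace ℝ (Fin 3)

variable {S : Type*} [TopologicalSpace S] [ChartedSpace (EuclideanSpace ℝ (Fin 3)) S]

namespace Family

theorem dt_apply (q : ℝ × S) (v : ℝ × 𝔼) : dt q v = v.1 := by
  have h : mfderiv (𝓘(ℝ, ℝ).prod (𝓡 3)) 𝓘(ℝ, ℝ) (Prod.fst : ℝ × S → ℝ) q
    = ContinuousLinearMap.fst ℝ ℝ 𝔼 := mfderiv_fst
  exact congrArg (fun L : ℝ × 𝔼 →L[ℝ] ℝ => L v) h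

theorem lift_apply (q : ℝ × S) (α : 𝔼 →L[ℝ] ℝ) (v : ℝ × 𝔼) : lift q α v = α v.2 := by
  have h : mfderiv (𝓘(ℝ, ℝ).prod (𝓡 3)) (𝓡 3) (Prod.snd : ℝ × S → S) q
    = ContinuousLinearMap.snd ℝ ℝ 𝔼 := mfderiv_snd
  exact congrArg (fun L : ℝ × 𝔼 →L[ℝ] 𝔼 => α (L v)) h

variable (F : Family S)

theorem g_apply (q : ℝ × S) (v w : ℝ × 𝔼) : F.g q v w
    = -(F.β q.1 q.2 * v.1 * (F.β q.1 q.2 * w.1))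
      + ∑ a, F.cof a q.1 q.2 v.2 * F.cof a q.1 q.2 w.2 := by
  have h : F.g q v w = -(F.β q.1 q.2 ^ 2) * (dt q v * dt q w)
      + lift q (F.cof 0 q.1 q.2) v * lift q (F.cof 0 q.1 q.2) w
      + lift q (F.cof 1 q.1 q.2) v * lift q (F.cof 1 q.1 q.2) w
      + lift q (F.cof 2 q.1 q.2) v * lift q (F.cof 2 q.1 q.2) w := rfl
  rw [h, Fin.sum_univ_three]
  simp only [dt_apply, lift_apply]
  ring

theorem u_apply (f : ℝ → S → ℝ) (q : ℝ × S) (v : ℝ × 𝔼) : F.u f q v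
    = Real.exp (f q.1 q.2) * (F.β q.1 q.2 * v.1 + F.cof 0 q.1 q.2 v.2) := by
  have h : F.u f q v
      = Real.exp (f q.1 q.2) * (F.β q.1 q.2 * dt q v + lift q (F.cof 0 q.1 q.2) v) := rfl
  rw [h, dt_apply, lift_apply]

end Family

theorem chart_prod_symm (t : ℝ) (p : S) (y : ℝ × 𝔼) :
    (extChartAt (𝓘(ℝ, ℝ).prod (𝓡 3)) ((t, p) : ℝ × S)).symm y
      = (y.1, (extChartAt (𝓡 3) p).symm y.2) := by
  rw [extChartAt_prod]
  rfl

variable [IsManifold (𝓡 3) ∞ S]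

theorem chartSymmDeriv_prod (t : ℝ) {p : S} {y : ℝ × 𝔼}
    (hy : y.2 ∈ (extChartAt (𝓡 3) p).target) (v : ℝ × 𝔼) :
    (chartSymmDeriv (𝓘(ℝ, ℝ).prod (𝓡 3)) ((t, p) : ℝ × S) y v : ℝ × 𝔼)
      = (v.1, chartFrame p y.2 v.2) := by
  have h : ((extChartAt (𝓘(ℝ, ℝ).prod (𝓡 3)) ((t, p) : ℝ × S)).symm : ℝ × 𝔼 → ℝ × S)
      = fun y => (y.1, (extChartAt (𝓡 3) p).symm y.2) := funext (chart_prod_symm t p)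
  have h1 : HasMFDerivAt 𝓘(ℝ, ℝ × 𝔼) (𝓡 3)
      (fun y : ℝ × 𝔼 => (extChartAt (𝓡 3) p).symm y.2) y
      ((chartFrame p y.2).comp (ContinuousLinearMap.snd ℝ ℝ 𝔼)) :=
    HasMFDerivAt.comp (I' := 𝓘(ℝ, 𝔼)) y (mdifferentiableAt_chartSymm hy).hasMFDerivAt
      (hasFDerivAt_snd.hasMFDerivAt)
  have h2 : HasMFDerivAt 𝓘(ℝ, ℝ × 𝔼) 𝓘(ℝ, ℝ) (Prod.fst : ℝ × 𝔼 → ℝ) y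
      (ContinuousLinearMap.fst ℝ ℝ 𝔼) := hasFDerivAt_fst.hasMFDerivAt
  have h3 := (h2.prodMk h1).mfderiv
  rw [← h] at h3
  exact congrArg (fun L : ℝ × 𝔼 →L[ℝ] ℝ × 𝔼 => L v) h3

theorem chartSymmDeriv_chartDeriv (t : ℝ) (p : S) (v : ℝ × 𝔼) :
    (chartSymmDeriv (𝓘(ℝ, ℝ).prod (𝓡 3)) ((t, p) : ℝ × S)
      (extChartAt (𝓘(ℝ, ℝ).prod (𝓡 3)) ((t, p) : ℝ × S) (t, p))
      (chartDeriv (𝓘(ℝ, ℝ).prod (𝓡 3)) ((t, p) : ℝ × S) v) : ℝ × 𝔼) = v := by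
  have := isManifold_one (S := S)
  have h := mfderivWithin_extChartAt_symm_comp_mfderiv_extChartAt'
    (I := 𝓘(ℝ, ℝ).prod (𝓡 3)) (mem_extChartAt_source ((t, p) : ℝ × S))
  rw [ModelWithCorners.Boundaryless.range_eq_univ, mfderivWithin_univ] at h
  exact congrArg (fun L : ℝ × 𝔼 →L[ℝ] ℝ × 𝔼 => L v) h

theorem metricInChart_g (F : Family S) (t : ℝ) {p : S} {y : ℝ × 𝔼}
    (hy : y.2 ∈ (extChartAt (𝓡 3) p).target) (i j : Unit ⊕ Fin 3) :
    metricInChart (𝓘(ℝ, ℝ).prod (𝓡 3)) basis4 F.g (t, p) y i j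
      = ∑ a, sign4 a * (coframe4 (F.βChart p) (F.cofChart p) a y (basis4 i)
        * coframe4 (F.βChart p) (F.cofChart p) a y (basis4 j)) := by
  have h := F.g_apply ((extChartAt (𝓘(ℝ, ℝ).prod (𝓡 3)) ((t, p) : ℝ × S)).symm y)
    (chartSymmDeriv (𝓘(ℝ, ℝ).prod (𝓡 3)) ((t, p) : ℝ × S) y (basis4 i))
    (chartSymmDeriv (𝓘(ℝ, ℝ).prod (𝓡 3)) ((t, p) : ℝ × S) y (basis4 j))
  refine Eq.trans h ?_
  rw [chartSymmDeriv_prod t hy, chartSymmDeriv_prod t hy, chart_prod_symm, Fintype.sum_sum_type]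
  simp [coframe4, sign4, Family.βChart, Family.cofChart, pullForm]

omit [IsManifold (𝓡 3) ∞ S] in
theorem metricInChart_h (F : Family S) (t : ℝ) (p : S) (x : 𝔼) (i j : Fin 3) :
    metricInChart (𝓡 3) basis3 (F.h t) p x i j
      = ∑ a, F.cofChart p a (t, x) (basis3 i) * F.cofChart p a (t, x) (basis3 j) := by
  have h : metricInChart (𝓡 3) basis3 (F.h t) p x i j
      = F.h t ((extChartAt (𝓡 3) p).symm x) (chartFrame p x (basis3 i))
        (chartFrame p x (basis3 j)) := rfl
  rw [h, F.h_eq]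
  exact coframeMetric_apply (E := 𝔼) (fun a => F.cof a t ((extChartAt (𝓡 3) p).symm x))
    (chartFrame p x (basis3 i)) (chartFrame p x (basis3 j))

variable {lam : ℝ} {J : Set ℝ} {F : Family S}

namespace IsKillingSpinorialFlow

variable (hF : IsKillingSpinorialFlow lam J F) (hJ : IsOpen J) {f : ℝ → S → ℝ}
  (hf : IsPotential lam J F f) {t : ℝ} (ht : t ∈ J) (p : S)
include hF hJ hf ht

theorem two_mul_nullCoeff_eq_hamiltonian :
    2 * FlowInCoordinates.nullCoeff lam (F.βChart p) (F.cofChart p) (F.vecChart p) (F.ΘChart p) (F.dβChart p)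
      (t, extChartAt (𝓡 3) p p) = F.hamiltonian lam t p := by
  have hy : ((t, extChartAt (𝓡 3) p p) : ℝ × 𝔼) ∈ J ×ˢ (extChartAt (𝓡 3) p).target :=
    ⟨ht, mem_extChartAt_target p⟩
  have hΘ : ∀ a c, F.ΘChart p a c (t, extChartAt (𝓡 3) p p) = F.ΘComp a c t p := fun a c => by
    rw [Family.ΘChart, extChartAt_to_inv]
  rw [(hF.flowInCoordinates hJ p hf).two_mul_nullCoeff hy basis3
    fun x _ => metricInChart_h F t p x]
  simp only [hΘ, Family.hamiltonian, hF.traceWrt_eq ht, hF.normSqWrt_eq ht, scalarCurv]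

theorem ricci_eq (v w : ℝ × 𝔼) :
    ricci (𝓘(ℝ, ℝ).prod (𝓡 3)) basis4 F.g (t, p) v w
      = -3 * lam ^ 2 * F.g (t, p) v w + 1 / 2 * F.hamiltonian lam t p * Real.exp (-2 * f t p)
          * (F.u f (t, p) v * F.u f (t, p) w) := by
  have hfl := hF.flowInCoordinates hJ p hf
  have hx := mem_extChartAt_target (I := 𝓡 3) p
  have hy : ((t, extChartAt (𝓡 3) p p) : ℝ × 𝔼) ∈ J ×ˢ (extChartAt (𝓡 3) p).target := ⟨ht, hx⟩
  have hy0 : extChartAt (𝓘(ℝ, ℝ).prod (𝓡 3)) ((t, p) : ℝ × S) (t, p)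
      = (t, extChartAt (𝓡 3) p p) := by
    rw [extChartAt_prod]
    rfl
  -- v' is the coordinate expression of v. The chart is trivial on the time factor, so only the
  -- spatial component is transformed.
  have key : ∀ v : ℝ × 𝔼, ∃ v' : ℝ × 𝔼,
      v' = chartDeriv (𝓘(ℝ, ℝ).prod (𝓡 3)) ((t, p) : ℝ × S) v ∧
      ((v'.1, chartFrame p (extChartAt (𝓡 3) p p) v'.2) : ℝ × 𝔼) = v := by
    intro v
    have h := chartSymmDeriv_chartDeriv t p v
    rw [hy0, chartSymmDeriv_prod t (y := (t, extChartAt (𝓡 3) p p)) hx] at h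
    exact ⟨_, rfl, h⟩
  obtain ⟨v', hv', hv⟩ := key v
  obtain ⟨hv1 : v'.1 = v.1, hv2 : chartFrame p _ v'.2 = v.2⟩ := Prod.ext_iff.1 hv
  obtain ⟨w', hw', hw⟩ := key w
  obtain ⟨hw1 : w'.1 = w.1, hw2 : chartFrame p _ w'.2 = w.2⟩ := Prod.ext_iff.1 hw
  have hric := hfl.isLeviCivita4.sum_ricciCoord_eq basis4
    (G := metricInChart (𝓘(ℝ, ℝ).prod (𝓡 3)) basis4 F.g (t, p))
    (fun y hy => metricInChart_g F t hy.2) hy v' w'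
  rw [hfl.ricci_eq hy] at hric
  have hl : ricci (𝓘(ℝ, ℝ).prod (𝓡 3)) basis4 F.g (t, p) v w
      = ∑ i, ∑ j, basis4.repr v' i * basis4.repr w' j
        * ricciCoord basis4 (metricInChart (𝓘(ℝ, ℝ).prod (𝓡 3)) basis4 F.g (t, p)) i j
          (t, extChartAt (𝓡 3) p p) := by
    rw [hv', hw', ← hy0]
    rfl
  have hβ : F.βChart p (t, extChartAt (𝓡 3) p p) = F.β t p := by
    rw [Family.βChart, extChartAt_to_inv]
  have hcof : ∀ a (z : 𝔼), F.cofChart p a (t, extChartAt (𝓡 3) p p) z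
      = F.cof a t p (chartFrame p (extChartAt (𝓡 3) p p) z) := fun a z => by
    simp only [Family.cofChart, pullForm, extChartAt_to_inv]
    rfl
  have hexp : Real.exp (-2 * f t p) * (Real.exp (f t p) * Real.exp (f t p)) = 1 := by
    rw [← Real.exp_add, ← Real.exp_add, ← Real.exp_zero]
    congr 1
    ring
  rw [hl, hric, F.g_apply, F.u_apply, F.u_apply, ← hF.two_mul_nullCoeff_eq_hamiltonian hJ hf ht p,
    Fintype.sum_sum_type]
  simp only [nullForm, coframe4, sign4, add_apply, smul_apply, smul_eq_mul,
    ContinuousLinearMap.comp_apply, ContinuousLinearMap.coe_fst', ContinuousLinearMap.coe_snd',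
    hβ, hcof, hv1, hv2, hw1, hw2, Finset.univ_unique, Finset.sum_singleton, one_mul]
  -- The two factors e^f of u ⊗ u cancel e^{-2f}, leaving N ν ⊗ ν.
  linear_combination (-FlowInCoordinates.nullCoeff lam (F.βChart p) (F.cofChart p) (F.vecChart p) (F.ΘChart p)
    (F.dβChart p) (t, extChartAt (𝓡 3) p p) * (F.β t p * v.1 + F.cof 0 t p v.2)
    * (F.β t p * w.1 + F.cof 0 t p w.2)) * hexp

end IsKillingSpinorialFlow

end Spacetime

/-! ### Primitives of closed one-forms s dt + A, smooth in time and space. -/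

section Primitive

open scoped Topology Interval
open MeasureTheory

variable {V : Type*} [NormedAddCommGroup V] [NormedSpace ℝ V] {J : Set ℝ} {W : Set V}
  {s : ℝ × V → ℝ} {A : ℝ × V → V →L[ℝ] ℝ} {φ : V → ℝ} {t₀ : ℝ}
  (hJ : IsOpen J) (hJ' : J.OrdConnected) (hW : IsOpen W) (ht₀ : t₀ ∈ J)
  (hs : ContDiffOn ℝ ∞ s (J ×ˢ W))
include hJ hJ' hW ht₀ hs

omit hW in
theorem hasDerivAt_primitive_time {t : ℝ} {x : V} (ht : t ∈ J) (hx : x ∈ W) :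
    HasDerivAt (fun r => ∫ z in t₀..r, s (z, x)) (s (t, x)) t := by
  have hc : ContinuousOn (fun z => s (z, x)) J :=
    hs.continuousOn.comp (by fun_prop) fun z hz => ⟨hz, hx⟩
  exact intervalIntegral.integral_hasDerivAt_right
    ((hc.mono (hJ'.uIcc_subset ht₀ ht)).intervalIntegrable)
    (hc.stronglyMeasurableAtFilter hJ t ht) (hc.continuousAt (hJ.mem_nhds ht))

theorem hasFDerivAt_primitive_space {t : ℝ} {x : V} (ht : t ∈ J) (hx : x ∈ W) :
    HasFDerivAt (fun x => ∫ z in t₀..t, s (z, x))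
      (∫ z in t₀..t, (fderiv ℝ s (z, x)).comp (ContinuousLinearMap.inr ℝ ℝ V)) x := by
  have hU : IsOpen (J ×ˢ W) := hJ.prod hW
  have hsub : uIcc t₀ t ⊆ J := hJ'.uIcc_subset ht₀ ht
  have hd : ContinuousOn (fderiv ℝ s) (J ×ˢ W) :=
    (hs.fderiv_of_isOpen (m := ∞) hU le_rfl).continuousOn
  have hcs : ∀ x ∈ W, ContinuousOn (fun z => s (z, x)) J := fun x hx =>
    hs.continuousOn.comp (by fun_prop) fun z hz => ⟨hz, hx⟩
  have hcd : ContinuousOn (fun z => fderiv ℝ s (z, x)) (uIcc t₀ t) :=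
    hd.comp (by fun_prop) fun z hz => ⟨hsub hz, hx⟩
  obtain ⟨C, hC⟩ := (isCompact_uIcc.image_of_continuousOn hcd.norm).bddAbove
  have hN : IsOpen ((J ×ˢ W) ∩ (fun y => ‖fderiv ℝ s y‖) ⁻¹' Iio (C + 1)) :=
    hd.norm.isOpen_inter_preimage hU isOpen_Iio
  -- The tube lemma spreads the bound on the derivative from the segment over x to nearby points. It
  -- gives the constant dominating function needed to differentiate under the integral.
  obtain ⟨u, v, -, hv, hu', hv', huv⟩ := generalized_tube_lemma (isCompact_uIcc (a := t₀) (b := t))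
    (isCompact_singleton (x := x)) hN (by
      rintro ⟨z, x'⟩ ⟨hz, hx' : x' = x⟩
      subst hx'
      exact ⟨⟨hsub hz, hx⟩, (hC ⟨z, hz, rfl⟩).trans_lt (lt_add_one C)⟩)
  have hmem : ∀ z ∈ Ι t₀ t, ∀ x ∈ v, (z, x) ∈ J ×ˢ W ∧ ‖fderiv ℝ s (z, x)‖ < C + 1 :=
    fun z hz x hx => huv ⟨hu' (uIoc_subset_uIcc hz), hx⟩
  refine intervalIntegral.hasFDerivAt_integral_of_dominated_of_fderiv_le (μ := volume)
    (F := fun x z => s (z, x))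
    (F' := fun x z => (fderiv ℝ s (z, x)).comp (ContinuousLinearMap.inr ℝ ℝ V))
    (bound := fun _ => (C + 1) * ‖ContinuousLinearMap.inr ℝ ℝ V‖)
    (hv.mem_nhds (hv' rfl)) ?_ ?_ ?_ ?_ intervalIntegrable_const ?_
  · filter_upwards [hW.mem_nhds hx] with x' hx'
    exact (((hcs x' hx').mono hsub).mono uIoc_subset_uIcc).aestronglyMeasurable measurableSet_uIoc
  · exact ((hcs x hx).mono hsub).intervalIntegrable
  · exact ((hcd.clm_comp continuousOn_const).mono uIoc_subset_uIcc).aestronglyMeasurable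
      measurableSet_uIoc
  · refine Filter.Eventually.of_forall fun z hz x' hx' => ?_
    exact (ContinuousLinearMap.opNorm_comp_le _ _).trans
      (mul_le_mul_of_nonneg_right (hmem z hz x' hx').2.le (norm_nonneg _))
  · refine Filter.Eventually.of_forall fun z hz x' hx' => ?_
    have h1 : DifferentiableAt ℝ s (z, x') :=
      (hs.contDiffAt (hU.mem_nhds (hmem z hz x' hx').1)).differentiableAt (by simp)
    exact h1.hasFDerivAt.comp x' (hasFDerivAt_prodMk_right z x')

variable (hA : ContDiffOn ℝ ∞ A (J ×ˢ W)) (hφ : ∀ x ∈ W, HasFDerivAt φ (A (t₀, x)) x)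
  (hsA : ∀ y ∈ J ×ˢ W, ∀ v, fderiv ℝ A y (1, 0) v = fderiv ℝ s y (0, v))
include hA hφ hsA

/-- The primitive of a closed one-form `s dt + A`, given its restriction `φ` to `t = t₀`. -/
theorem hasFDerivAt_primitive {y : ℝ × V} (hy : y ∈ J ×ˢ W) :
    HasFDerivAt (fun y : ℝ × V => φ y.2 + ∫ z in t₀..y.1, s (z, y.2))
      ((ContinuousLinearMap.toSpanSingleton ℝ (s y)).coprod (A y)) y := by
  have hU : IsOpen (J ×ˢ W) := hJ.prod hW
  have hsub : ∀ t ∈ J, uIcc t₀ t ⊆ J := fun t ht => hJ'.uIcc_subset ht₀ ht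
  refine (hasStrictFDerivAt_uncurry_coprod (𝕜 := ℝ) (u := y)
    (f := fun t x => φ x + ∫ z in t₀..t, s (z, x))
    (f₁ := fun t x => ContinuousLinearMap.toSpanSingleton ℝ (s (t, x)))
    (f₂ := fun t x => A (t, x)) ?_ ?_ ?_ ?_).hasFDerivAt
  · filter_upwards [hU.mem_nhds hy] with y hy
    exact ((hasDerivAt_primitive_time hJ hJ' ht₀ hs hy.1 hy.2).const_add _).hasFDerivAt
  · filter_upwards [hU.mem_nhds hy] with ⟨t, x⟩ hy
    obtain ⟨ht : t ∈ J, hx : x ∈ W⟩ := hy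
    have h1 := (hφ x hx).add (hasFDerivAt_primitive_space hJ hJ' hW ht₀ hs ht hx)
    have hdA : ∀ z ∈ J, HasDerivAt (fun z => A (z, x))
        ((fderiv ℝ s (z, x)).comp (ContinuousLinearMap.inr ℝ ℝ V)) z := by
      intro z hz
      have h2 : DifferentiableAt ℝ A (z, x) :=
        (hA.contDiffAt (hU.mem_nhds ⟨hz, hx⟩)).differentiableAt (by simp)
      have h3 : HasFDerivAt (fun z => A (z, x)) _ z :=
        h2.hasFDerivAt.comp z (hasFDerivAt_prodMk_left z x)
      refine h3.hasDerivAt.congr_deriv ?_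
      ext v
      simpa using hsA (z, x) ⟨hz, hx⟩ v
    have hcd : ContinuousOn (fun z => (fderiv ℝ s (z, x)).comp (ContinuousLinearMap.inr ℝ ℝ V))
        (uIcc t₀ t) :=
      ((hs.fderiv_of_isOpen (m := ∞) hU le_rfl).continuousOn.comp (by fun_prop)
        fun z hz => ⟨hsub t ht hz, hx⟩).clm_comp continuousOn_const
    -- Closedness turns ∂_x s into ∂_t A, whose integral is A(t) - A(t₀); the term A(t₀) is
    -- cancelled by dφ.
    rw [intervalIntegral.integral_eq_sub_of_hasDerivAt (fun z hz => hdA z (hsub t ht hz))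
      hcd.intervalIntegrable] at h1
    exact h1.congr_fderiv (add_sub_cancel _ _)
  · have h1 : ContinuousAt s y := hs.continuousOn.continuousAt (hU.mem_nhds hy)
    exact (ContinuousLinearMap.toSpanSingletonCLE (𝕜 := ℝ) (E := ℝ)).continuous.continuousAt.comp h1
  · exact hA.continuousOn.continuousAt (hU.mem_nhds hy)

/-- The derivative is the smooth form s dt + A, so smoothness follows without differentiating the
integral again. -/
theorem contDiffOn_primitive :
    ContDiffOn ℝ ∞ (fun y : ℝ × V => φ y.2 + ∫ z in t₀..y.1, s (z, y.2)) (J ×ˢ W) := by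
  have hU : IsOpen (J ×ˢ W) := hJ.prod hW
  have h := fun y hy => hasFDerivAt_primitive hJ hJ' hW ht₀ hs hA hφ hsA (y := y) hy
  rw [contDiffOn_infty_iff_fderiv_of_isOpen hU]
  refine ⟨fun y hy => (h y hy).differentiableAt.differentiableWithinAt, ?_⟩
  have h1 : ContDiffOn ℝ ∞ (fun y => s y • ContinuousLinearMap.fst ℝ ℝ V
      + (A y).comp (ContinuousLinearMap.snd ℝ ℝ V)) (J ×ˢ W) :=
    (hs.smul contDiffOn_const).add (hA.clm_comp contDiffOn_const)
  refine h1.congr fun y hy => ?_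
  rw [(h y hy).fderiv]
  ext <;> simp

end Primitive

/-! ### Existence of the potential f. -/

section Potential

open scoped Topology

local notation "𝔼" => EuclideanSpace ℝ (Fin 3)

variable {S : Type*} [TopologicalSpace S] [ChartedSpace (EuclideanSpace ℝ (Fin 3)) S]
  [IsManifold (𝓡 3) ∞ S] {lam : ℝ} {J : Set ℝ} {F : Family S}

omit [IsManifold (𝓡 3) ∞ S] in
theorem SmoothFunctions.of_chart (hJ : IsOpen J) {f : ℝ → S → ℝ}
    (hf : ∀ p, ContDiffOn ℝ ∞ (fun y : ℝ × 𝔼 => f y.1 ((extChartAt (𝓡 3) p).symm y.2))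
      (J ×ˢ (extChartAt (𝓡 3) p).target)) : SmoothFunctions J f := by
  rintro ⟨t, p⟩ ⟨ht, -⟩
  have h1 : ContMDiffAt (𝓘(ℝ, ℝ).prod (𝓡 3)) 𝓘(ℝ, ℝ × 𝔼) ∞
      (fun q : ℝ × S => (q.1, extChartAt (𝓡 3) p q.2)) (t, p) :=
    contMDiffAt_fst.prodMk_space
      (ContMDiffAt.comp (t, p) (contMDiffAt_extChartAt (x := p)) contMDiffAt_snd)
  have h2 : ContMDiffAt 𝓘(ℝ, ℝ × 𝔼) 𝓘(ℝ, ℝ) ∞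
      (fun y : ℝ × 𝔼 => f y.1 ((extChartAt (𝓡 3) p).symm y.2)) (t, extChartAt (𝓡 3) p p) :=
    ((hf p).contDiffAt (chart_mem_nhds hJ ht (mem_extChartAt_target p))).contMDiffAt
  refine ((ContMDiffAt.comp (t, p) h2 h1).congr_of_eventuallyEq ?_).contMDiffWithinAt
  have h3 : univ ×ˢ (extChartAt (𝓡 3) p).source ∈ 𝓝 ((t, p) : ℝ × S) :=
    (isOpen_univ.prod (isOpen_extChartAt_source p)).mem_nhds
      ⟨mem_univ _, mem_extChartAt_source p⟩
  filter_upwards [h3] with q hq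
  simp only [Function.comp_apply, (extChartAt (𝓡 3) p).left_inv hq.2]

namespace Family

variable (F) in
/-- The one-form `-Θ(e_u) - λ e_l` in the preferred chart at `p`. -/
def potentialForm (lam : ℝ) (p : S) (y : ℝ × 𝔼) : 𝔼 →L[ℝ] ℝ :=
  -(∑ c, F.ΘChart p 0 c y • F.cofChart p c y) - lam • F.cofChart p 1 y

end Family

namespace IsKillingSpinorialFlow

variable (hF : IsKillingSpinorialFlow lam J F) (hJ : IsOpen J)
include hF

theorem potentialForm_apply {p : S} {t : ℝ} {x : 𝔼} (ht : t ∈ J)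
    (hx : x ∈ (extChartAt (𝓡 3) p).target) (v : 𝔼) : F.potentialForm lam p (t, x) v
      = -F.ΘOf t ((extChartAt (𝓡 3) p).symm x) (F.eu t ((extChartAt (𝓡 3) p).symm x))
          (chartFrame p x v)
        - lam * F.el t ((extChartAt (𝓡 3) p).symm x) (chartFrame p x v) := by
  have h := hF.ΘOf_chartFrame (y := (t, x)) ⟨ht, hx⟩ 0 v
  have h2 : F.potentialForm lam p (t, x) v
      = -(∑ c, F.ΘChart p 0 c (t, x) * F.cofChart p c (t, x) v)
        - lam * F.cofChart p 1 (t, x) v := by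
    simp [Family.potentialForm]
  rw [h2, ← h]
  rfl

theorem potentialForm_chartCoframe {p : S} {t : ℝ} {x : 𝔼} (ht : t ∈ J)
    (hx : x ∈ (extChartAt (𝓡 3) p).target) (w : 𝔼) :
    F.potentialForm lam p (t, x) (chartCoframe p x w)
      = -F.ΘOf t ((extChartAt (𝓡 3) p).symm x) (F.eu t ((extChartAt (𝓡 3) p).symm x)) w
        - lam * F.el t ((extChartAt (𝓡 3) p).symm x) w :=
  (hF.potentialForm_apply ht hx _).trans (congrArg (fun z : 𝔼 =>
    -F.ΘOf t ((extChartAt (𝓡 3) p).symm x) (F.eu t ((extChartAt (𝓡 3) p).symm x)) z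
      - lam * F.el t ((extChartAt (𝓡 3) p).symm x) z) (chartFrame_chartCoframe hx w))

include hJ

theorem smoothFunctions_dβComp (a : Fin 3) : SmoothFunctions J (F.dβComp a) :=
  SmoothFunctions.of_chart hJ fun p => hF.contDiffOn_dβChart hJ p a

theorem contDiffOn_potentialForm (p : S) :
    ContDiffOn ℝ ∞ (F.potentialForm lam p) (J ×ˢ (extChartAt (𝓡 3) p).target) :=
  (ContDiffOn.sum fun c _ => (hF.contDiffOn_ΘChart hJ p 0 c).smul
    (hF.contDiffOn_cofChart p c)).neg.sub ((hF.contDiffOn_cofChart p 1).const_smul lam)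

/-- The one-form `dβ(e_u) dt - Θ(e_u) - λ e_l` is closed in the directions containing `∂_t`. -/
theorem fderiv_potentialForm_time {p : S} {y : ℝ × 𝔼}
    (hy : y ∈ J ×ˢ (extChartAt (𝓡 3) p).target) (v : 𝔼) :
    fderiv ℝ (F.potentialForm lam p) y (1, 0) v = fderiv ℝ (F.dβChart p 0) y (0, v) := by
  obtain ⟨t, x⟩ := y
  obtain ⟨ht : t ∈ J, hx : x ∈ (extChartAt (𝓡 3) p).target⟩ := hy
  set q := (extChartAt (𝓡 3) p).symm x with hq
  have hd : DifferentiableAt ℝ (F.potentialForm lam p) (t, x) :=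
    ((hF.contDiffOn_potentialForm hJ p).contDiffAt (chart_mem_nhds hJ ht hx)).differentiableAt
      (by simp)
  have hel : HasDerivAt (F := 𝔼 →L[ℝ] ℝ) (fun r => F.el r q)
      (deriv (F := 𝔼 →L[ℝ] ℝ) (fun r => F.el r q) t) t :=
    (hF.smooth_el.hasDerivAt hJ ht hx).differentiableAt.hasDerivAt
  have h1 := ((hasDerivAt_slice hd).clm_comp (hasDerivAt_const t (chartCoframe p x))).neg.sub
    (hel.const_smul lam)
  -- Smoothness of Θ(e_u) in time is known through its chart expression. Writing it as minus the
  -- potential form minus λ e_l gives an actual derivative, to which the `deriv` in the evolution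
  -- equation is equal.
  simp only [ContinuousLinearMap.comp_zero, add_zero] at h1
  have h2 : HasDerivAt (F := 𝔼 →L[ℝ] ℝ) (fun r => F.ΘOf r q (F.eu r q))
      (-(fderiv ℝ (F.potentialForm lam p) (t, x) (1, 0)).comp (chartCoframe p x)
        - lam • deriv (F := 𝔼 →L[ℝ] ℝ) (fun r => F.el r q) t) t := by
    refine h1.congr_of_eventuallyEq ?_
    filter_upwards [hJ.mem_nhds ht] with r hr
    refine ContinuousLinearMap.ext fun w => ?_
    have h3 := hF.potentialForm_chartCoframe (p := p) hr hx w
    change F.ΘOf r q (F.eu r q) w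
      = -(F.potentialForm lam p (r, x) (chartCoframe p x w)) - lam * F.el r q w
    rw [h3]
    ring
  have h4 := congrArg (fun L : 𝔼 →L[ℝ] ℝ => L (chartFrame p x v)) (hF.evol_Θ t ht q)
  have h5 := (hF.smoothFunctions_dβComp hJ 0).fderiv_chart_space hJ ht hx v
  have h6 := congrArg (fun L : 𝔼 →L[ℝ] ℝ => L (chartFrame p x v)) h2.deriv
  have h7 : deriv (F := 𝔼 →L[ℝ] ℝ) (fun r => F.ΘOf r q (F.eu r q)) t (chartFrame p x v)
      + lam * deriv (F := 𝔼 →L[ℝ] ℝ) (fun r => F.el r q) t (chartFrame p x v)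
      = -(mvfderiv (𝓡 3) (F.dβComp 0 t) q (chartFrame p x v)) := h4
  have h8 : deriv (F := 𝔼 →L[ℝ] ℝ) (fun r => F.ΘOf r q (F.eu r q)) t (chartFrame p x v)
      = -(fderiv ℝ (F.potentialForm lam p) (t, x) (1, 0) (chartCoframe p x (chartFrame p x v)))
        - lam * deriv (F := 𝔼 →L[ℝ] ℝ) (fun r => F.el r q) t (chartFrame p x v) := h6
  rw [chartCoframe_chartFrame hx] at h8
  have h9 : fderiv ℝ (F.dβChart p 0) (t, x) (0, v)
      = mvfderiv (𝓡 3) (F.dβComp 0 t) q (chartFrame p x v) := h5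
  rw [h9]
  linarith

theorem exists_isPotential (hJ' : J.OrdConnected) : ∃ f : ℝ → S → ℝ, IsPotential lam J F f := by
  -- The construction needs a base time t₀; over an empty interval the conditions are void.
  rcases J.eq_empty_or_nonempty with rfl | ⟨t₀, ht₀⟩
  · exact ⟨fun _ _ => 0, contMDiffOn_const, fun t ht => ht.elim, fun t ht => ht.elim⟩
  obtain ⟨φ, hφs, hφ⟩ := hF.exact_form t₀ ht₀
  -- Exactness is used at the single time t₀, where φ is a primitive of Θ(e_u) + λ e_l; hence the
  -- minus sign. This f is defined globally on `S`, so charts serve only to check its derivatives.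
  let f : ℝ → S → ℝ := fun t p => -φ p + ∫ r in t₀..t, F.dβComp 0 r p
  have hφd : ∀ p : S, ∀ x ∈ (extChartAt (𝓡 3) p).target,
      HasFDerivAt (fun x => -φ ((extChartAt (𝓡 3) p).symm x)) (F.potentialForm lam p (t₀, x)) x := by
    intro p x hx
    have hm : MDifferentiableAt (𝓡 3) 𝓘(ℝ, ℝ) φ ((extChartAt (𝓡 3) p).symm x) :=
      hφs.mdifferentiableAt (by simp)
    have h1 : DifferentiableAt ℝ (fun x => φ ((extChartAt (𝓡 3) p).symm x)) x :=
      (hm.comp x (mdifferentiableAt_chartSymm hx)).differentiableAt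
    refine h1.hasFDerivAt.neg.congr_fderiv ?_
    ext v
    rw [hF.potentialForm_apply ht₀ hx, neg_apply, fderiv_comp_chartSymm hx hm, hφ]
    exact neg_add' _ _
  have hder : ∀ p : S, ∀ y ∈ J ×ˢ (extChartAt (𝓡 3) p).target,
      HasFDerivAt (fun y : ℝ × 𝔼 => f y.1 ((extChartAt (𝓡 3) p).symm y.2))
        ((ContinuousLinearMap.toSpanSingleton ℝ (F.dβChart p 0 y)).coprod
          (F.potentialForm lam p y)) y := fun p y hy =>
    hasFDerivAt_primitive hJ hJ' (isOpen_chartTarget p) ht₀ (hF.contDiffOn_dβChart hJ p 0)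
      (hF.contDiffOn_potentialForm hJ p) (hφd p) (fun y hy => hF.fderiv_potentialForm_time hJ hy) hy
  have hsm : SmoothFunctions J f := SmoothFunctions.of_chart hJ fun p =>
    contDiffOn_primitive hJ hJ' (isOpen_chartTarget p) ht₀ (hF.contDiffOn_dβChart hJ p 0)
      (hF.contDiffOn_potentialForm hJ p) (hφd p) (fun y hy => hF.fderiv_potentialForm_time hJ hy)
  refine ⟨f, hsm, fun t ht p => ?_, fun t ht p => ?_⟩
  · have hx := mem_extChartAt_target (I := 𝓡 3) p
    -- The point is written as the inverse chart of its own coordinates, the form in which the chart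
    -- formulas apply.
    rw [← extChartAt_to_inv (I := 𝓡 3) p]
    set x := extChartAt (𝓡 3) p p
    refine ContinuousLinearMap.ext fun w => ?_
    have h1 := hsm.fderiv_chart_space hJ ht hx (chartCoframe p x w)
    rw [(hder p (t, x) ⟨ht, hx⟩).fderiv, ContinuousLinearMap.coprod_apply, map_zero,
      zero_add] at h1
    exact ((hF.potentialForm_chartCoframe ht hx w).symm.trans (h1.trans (congrArg
      (fun z : 𝔼 => mvfderiv (𝓡 3) (f t) ((extChartAt (𝓡 3) p).symm x) z)
      (chartFrame_chartCoframe hx w)))).symm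
  · have hx := mem_extChartAt_target (I := 𝓡 3) p
    have h1 := hsm.fderiv_chart_time hJ ht hx
    rw [(hder p (t, _) ⟨ht, hx⟩).fderiv, ContinuousLinearMap.coprod_apply, map_zero, add_zero,
      ContinuousLinearMap.toSpanSingleton_apply, one_smul, Family.dβChart, extChartAt_to_inv] at h1
    exact h1.symm

end IsKillingSpinorialFlow

end Potential

end KillingFlow

end

open KillingFlow in
theorem mainTheorem8 {S : Type*} [TopologicalSpace S] [T2Space S] [SecondCountableTopology S]
    [ChartedSpace (EuclideanSpace ℝ (Fin 3)) S] [IsManifold (𝓡 3) ∞ S]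
    (lam : ℝ) (J : Set ℝ) (hJ : IsOpen J) (hJ' : J.OrdConnected)
    (F : Family S) (hF : IsKillingSpinorialFlow lam J F) :
    (∃ f : ℝ → S → ℝ, IsPotential lam J F f) ∧
    ∀ f : ℝ → S → ℝ, IsPotential lam J F f →
      ∀ t ∈ J, ∀ p : S, ∀ X Y : TangentSpace (𝓘(ℝ, ℝ).prod (𝓡 3)) ((t, p) : ℝ × S),
        ricci (𝓘(ℝ, ℝ).prod (𝓡 3)) basis4 F.g (t, p) X Y
          = -3 * lam ^ 2 * F.g (t, p) X Y
            + 1 / 2 * F.hamiltonian lam t p * Real.exp (-2 * f t p)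
              * (F.u f (t, p) X * F.u f (t, p) Y) :=
  ⟨hF.exists_isPotential hJ hJ', fun _ hf _ ht p X Y => hF.ricci_eq hJ hf ht p X Y⟩
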